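/- Let $\lambda_1,\dots,\lambda_n\in\mathbb R$ satisfy the $\mathbb N$-linearity condition: for all $(a_1,\dots,a_n)\in\mathbb N^n$ with $a_1+\dots+a_n\ge 2$ and all $i$, $a_1\lambda_1+\dots+a_n\lambda_n-\lambda_i\neq 0$ (so that in particular every $\lambda_i\ne0$). Let $V_0(\mathbf x)=\sum_i\lambda_i x_i\partial_i$, with flow $F_t(\mathbf x)=(x_ie^{\lambda_i t})_i$, and for $\mathbf x\in\mathbb R^n$ let $\mathbf x_u$ and $\mathbf x_s$ be the components of $\mathbf x$ in the coordinates with $\lambda_i>0$ and $\lambda_i<0$ respectively. Let $V$ be a smooth vector field on $\mathbb R^n$ such that $V-V_0$ has compact support and such that, for every large enough positive integer $\alpha$, there is a constant $K=K(\alpha)$ with $$|V-V_0|(\mathbf x)\le K|\mathbf x_u|^\alpha|\mathbf x_s|^\alpha\qquad\text{for all }\mathbf x .$$ For $1<p<\infty$, $k\in\mathbb N=\{0,1,\dots\}$ and $\delta\in\mathbb R$ let $L^p_{k,\delta}((-\infty,0];\mathbb R^n)$ be the weighted Sobolev space of functions $u$ whose weak derivatives $u^{(j)}$, $0\le j\le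 k$, exist and for which $$\|u\|_{p,k,\delta}=\sum_{j=0}^k\Big[\int_{-\infty}^0e^{-\delta pt}|u^{(j)}(t)|^p\,dt\Big]^{1/p}<\infty,$$ let $\Omega(r)=\{u\in L^p_{k,\delta}:\|u\|_{p,k,\delta}\le r\}$, and put $$\mathfrak F_{\mathbf x}(u)(t)=\int_{-\infty}^t\big[V(u(s)+F_s\mathbf x)-V_0(F_s\mathbf x)\big]\,ds .$$ Theorem. For all $p>1$, $k\in\mathbb N$ and $r>0$ there is $\delta_0>0$ such that for every $\delta\ge\delta_0$ there are $R_0>0$ and $0<C<1$ such that for every $0<R\le R_0$ and every $\mathbf x\in U=B_{\mathbf 0}(R)$: for each $\gamma\in\Omega(r)$ the integrand defining $\mathfrak F_{\mathbf x}(\gamma)$ is integrable on $(-\infty,0]$ and $\mathfrak F_{\mathbf x}(\gamma)\in\Omega(r)$; and for all $\gamma_1,\gamma_2\in\Omega(r)$ $$\|\mathfrak F_{\mathbf x}(\gamma_1)-\mathfrak F_{\mathbf x}(\gamma_2)\|_{p,k,\delta}\le C\,\|\gamma_1-\gamma_2\|_{p,k,\delta}.$$ -/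

import Mathlib

open MeasureTheory Set
open scoped ENNReal ContDiff

noncomputable section

namespace MorseContraction

/-- `ℝⁿ` with the Euclidean norm. -/
abbrev E (n : ℕ) : Type := EuclideanSpace ℝ (Fin n)

/-- The `ℕ`-linearity condition: `a₁ λ₁ + ⋯ + aₙ λₙ - λᵢ = 0` has no solution
`a ∈ ℕⁿ` with `a₁ + ⋯ + aₙ ≥ 2`, for any `i`. -/
def NLinear {n : ℕ} (lam : Fin n → ℝ) : Prop :=
  ∀ a : Fin n → ℕ, 2 ≤ ∑ j, a j → ∀ i, (∑ j, (a j : ℝ) * lam j) - lam i ≠ 0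

/-- The standard form `V₀(x) = ∑ᵢ λᵢ xᵢ ∂ᵢ`. -/
def standardForm {n : ℕ} (lam : Fin n → ℝ) (x : E n) : E n :=
  WithLp.toLp 2 fun i => lam i * x i

/-- The flow `F_t(x)ᵢ = xᵢ exp(λᵢ t)` of the standard form. -/
def standardFlow {n : ℕ} (lam : Fin n → ℝ) (t : ℝ) (x : E n) : E n :=
  WithLp.toLp 2 fun i => x i * Real.exp (lam i * t)

/-- `standardFlow` is indeed the flow of `standardForm`. -/
theorem standardFlow_spec {n : ℕ} (lam : Fin n → ℝ) (x : E n) :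
    standardFlow lam 0 x = x ∧
      ∀ t : ℝ, HasDerivAt (fun s => standardFlow lam s x)
        (standardForm lam (standardFlow lam t x)) t := by
  refine ⟨by ext i; simp [standardFlow], fun t => ?_⟩
  have h : HasDerivAt (fun (s : ℝ) (i : Fin n) => x i * Real.exp (lam i * s))
      (fun i => x i * (Real.exp (lam i * t) * (lam i * 1))) t :=
    hasDerivAt_pi.2 fun i =>
      (((hasDerivAt_id t).const_mul (lam i)).exp).const_mul (x i)
  have h' := (PiLp.hasFDerivAt_toLp (𝕜 := ℝ) 2
    (fun i => x i * Real.exp (lam i * t))).comp_hasDerivAt t h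
  have e : standardForm lam (standardFlow lam t x)
      = WithLp.toLp 2 fun i => x i * (Real.exp (lam i * t) * (lam i * 1)) := by
    ext i
    simp only [standardForm, standardFlow]
    ring
  rw [e]
  exact h'

/-- The component of `x` in the unstable directions (those with `λᵢ > 0`). -/
def unstablePart {n : ℕ} (lam : Fin n → ℝ) (x : E n) : E n :=
  WithLp.toLp 2 fun i => if 0 < lam i then x i else 0

/-- The component of `x` in the stable directions (those with `λᵢ < 0`). -/
def stablePart {n : ℕ} (lam : Fin n → ℝ) (x : E n) : E n :=
  WithLp.toLp 2 fun i => if lam i < 0 then x i else 0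

/-- `v` is the `j`-th weak derivative of `u` on the half line `(-∞, 0]`. Functions on the half
line are given by functions on `ℝ`, of which only the values on `(-∞, 0]` matter (up to null
sets). -/
def IsWeakDeriv {n : ℕ} (j : ℕ) (u v : ℝ → E n) : Prop :=
  LocallyIntegrableOn u (Iio 0) ∧ LocallyIntegrableOn v (Iio 0) ∧
    ∀ φ : ℝ → ℝ, ContDiff ℝ ∞ φ → HasCompactSupport φ → tsupport φ ⊆ Iio 0 →
      ∫ t in Iio (0 : ℝ), iteratedDeriv j φ t • u t
        = (-1 : ℝ) ^ j • ∫ t in Iio (0 : ℝ), φ t • v t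

/-- The weighted Sobolev norm
`‖u‖_{p,k,δ} = ∑_{j=0}^k (∫_{-∞}^0 exp(-δpt) |u^{(j)}(t)|^p dt)^{1/p}` in `[0, ∞]`, where `u^{(j)}`
is the `j`-th weak derivative. The infimum runs over the representatives of the weak derivative,
which all agree almost everywhere; it is `∞` if there is no weak derivative. -/
def wNorm {n : ℕ} (p : ℝ) (k : ℕ) (δ : ℝ) (u : ℝ → E n) : ℝ≥0∞ :=
  ∑ j ∈ Finset.range (k + 1), ⨅ (v : ℝ → E n) (_ : IsWeakDeriv j u v),
    eLpNorm (fun t => Real.exp (-δ * t) • v t) (ENNReal.ofReal p) (volume.restrict (Iic 0))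

/-- The weighted Sobolev space `L^p_{k,δ}((-∞,0]; ℝⁿ)`. Since the weight is bounded above and below
on compact subsets of `(-∞, 0]`, functions of finite norm lie in `L^p_{k,loc}`. -/
def wSobolev (n : ℕ) (p : ℝ) (k : ℕ) (δ : ℝ) : Set (ℝ → E n) :=
  {u | wNorm p k δ u < ⊤}

/-- The closed ball `Ω(r)` of `L^p_{k,δ}`. -/
def Omega (n : ℕ) (p : ℝ) (k : ℕ) (δ r : ℝ) : Set (ℝ → E n) :=
  {u | u ∈ wSobolev n p k δ ∧ wNorm p k δ u ≤ ENNReal.ofReal r}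

/-- The integrand `V(u(s) + F_s x) - V₀(F_s x)`. -/
def integrand {n : ℕ} (lam : Fin n → ℝ) (V : E n → E n) (x : E n) (u : ℝ → E n) (s : ℝ) : E n :=
  V (u s + standardFlow lam s x) - standardForm lam (standardFlow lam s x)

/-- The operator `𝔉_x(u)(t) = ∫_{-∞}^t [V(u(s) + F_s x) - V₀(F_s x)] ds`. -/
def opF {n : ℕ} (lam : Fin n → ℝ) (V : E n → E n) (x : E n) (u : ℝ → E n) (t : ℝ) : E n :=
  ∫ s in Iic t, integrand lam V x u s

end MorseContraction

end

/-! Write `V = V₀ + N` with `N = nonlin lam V`. Since `V₀` is linear, the integrand is `V₀(u(s)) +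
N(u(s) + F_s x)`. Two estimates give the theorem.

Contraction. Hardy's inequality bounds integration from `-∞` by `1 / δ` in the norm weighted by `exp
(-δ t)` (`eLpNorm_weighted_prim_le`). An element of the Sobolev space is a.e. a `k`-fold primitive
of a weighted `L^p` function (`exists_prim_iterate_of_wNorm_lt_top`). Its derivatives of order below
`k` are therefore bounded pointwise by `r`, with constant 1 for every `δ ≥ 1`, so the Lipschitz
constants of the jet map `u ↦ (N(u + F x))^{(j)}` do not depend on `δ` or `x`. Each derivative of
`𝔉(u₁) - 𝔉(u₂)` involves one primitive to which Hardy applies. The Lipschitz constant is thus `D /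
δ` with `D` independent of `δ` (`exists_wNorm_opF_sub_le`), and large `δ` makes it at most `1/2`.

Size at the zero curve. The integrand of `𝔉(0)` is `N(F_s x)`. Backward in time the unstable part of
the orbit decays exponentially, and on the support of `N` the stable part is bounded, so flatness to
high order gives any prescribed exponential rate. A Landau inequality carries the decay over to
derivatives (`IsFlat.exists_norm_iteratedDeriv_nonlin_flow_le`), so `‖𝔉(0)‖ ≤ const · R`. The
constant depends on `δ`, hence `R₀` is chosen after `δ`. The triangle inequality then gives `‖𝔉(γ)‖
≤ r/2 + r/2`. -/

noncomputable section

namespace MorseContraction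

/-! ### Weighted `L^p` estimates for the primitive from `-∞`. -/

section

/-- Schur's test for a kernel whose rows and columns have the same mass bound. -/
theorem lintegral_kernel_rpow_le {α β : Type*} [MeasurableSpace α] [MeasurableSpace β]
    {μ : Measure α} {ν : Measure β} [SFinite μ] [SFinite ν] {p : ℝ} (hp : 1 < p)
    {K : α → β → ℝ≥0∞} (hK : Measurable (Function.uncurry K)) {h : β → ℝ≥0∞}
    (hh : AEMeasurable h ν) {A : ℝ≥0∞} (hA : A ≠ ⊤)
    (h₁ : ∀ t, ∫⁻ s, K t s ∂ν ≤ A) (h₂ : ∀ s, ∫⁻ t, K t s ∂μ ≤ A) :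
    ∫⁻ t, (∫⁻ s, K t s * h s ∂ν) ^ p ∂μ ≤ A ^ p * ∫⁻ s, h s ^ p ∂ν := by
  have hpq := Real.HolderConjugate.conjExponent hp
  set q := p.conjExponent
  have hp0 : 0 < p := hpq.pos
  have hq0 : 0 < q := hpq.symm.pos
  have hKt : ∀ t, Measurable (K t) := fun t => hK.of_uncurry_left
  -- Hölder after splitting `K = K^{1/q} · K^{1/p}`: the first factor has row mass at most `A`, the
  -- second keeps `h^p` integrated against `K`, ready for Tonelli and the column bound.
  have key : ∀ t, (∫⁻ s, K t s * h s ∂ν) ^ p ≤ A ^ (p / q) * ∫⁻ s, K t s * h s ^ p ∂ν := by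
    intro t
    have hsplit : ∀ s, K t s * h s = (K t s) ^ (1 / q) * ((K t s) ^ (1 / p) * h s) := by
      intro s
      rw [← mul_assoc, ← ENNReal.rpow_add_of_nonneg _ _ (by positivity) (by positivity)]
      have : 1 / q + 1 / p = 1 := by
        have := hpq.inv_add_inv_eq_one
        simp only [one_div]; linarith
      rw [this, ENNReal.rpow_one]
    have hH := ENNReal.lintegral_mul_le_Lp_mul_Lq ν hpq.symm
      (f := fun s => (K t s) ^ (1 / q)) (g := fun s => (K t s) ^ (1 / p) * h s)
      ((hKt t).pow_const _).aemeasurable (((hKt t).pow_const _).aemeasurable.mul hh)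
    simp only [Pi.mul_apply] at hH
    simp_rw [← hsplit] at hH
    calc (∫⁻ s, K t s * h s ∂ν) ^ p ≤ _ := ENNReal.rpow_le_rpow hH hp0.le
      _ = (∫⁻ s, K t s ∂ν) ^ (p / q) * ∫⁻ s, K t s * h s ^ p ∂ν := by
          rw [ENNReal.mul_rpow_of_nonneg _ _ hp0.le, ← ENNReal.rpow_mul, ← ENNReal.rpow_mul]
          have e1 : ∀ s, (K t s ^ (1 / q)) ^ q = K t s := fun s => by
            rw [← ENNReal.rpow_mul, one_div_mul_cancel hq0.ne', ENNReal.rpow_one]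
          have e2 : ∀ s, (K t s ^ (1 / p) * h s) ^ p = K t s * h s ^ p := fun s => by
            rw [ENNReal.mul_rpow_of_nonneg _ _ hp0.le, ← ENNReal.rpow_mul,
              one_div_mul_cancel hp0.ne', ENNReal.rpow_one]
          simp_rw [e1, e2]
          rw [one_div_mul_cancel hp0.ne', ENNReal.rpow_one]
          congr 2; ring
      _ ≤ _ := by gcongr; exact h₁ t
  have hpq1 : p / q + 1 = p := by
    have := hpq.inv_add_inv_eq_one
    field_simp at this ⊢
    linarith
  calc ∫⁻ t, (∫⁻ s, K t s * h s ∂ν) ^ p ∂μ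
      ≤ ∫⁻ t, A ^ (p / q) * ∫⁻ s, K t s * h s ^ p ∂ν ∂μ := lintegral_mono key
    _ = A ^ (p / q) * ∫⁻ t, ∫⁻ s, K t s * h s ^ p ∂ν ∂μ :=
        lintegral_const_mul' _ _ (ENNReal.rpow_ne_top_of_nonneg (by positivity) hA)
    _ = A ^ (p / q) * ∫⁻ s, ∫⁻ t, K t s * h s ^ p ∂μ ∂ν := by
        rw [lintegral_lintegral_swap]
        exact hK.aemeasurable.mul ((hh.pow_const p).comp_snd)
    _ ≤ A ^ (p / q) * ∫⁻ s, A * h s ^ p ∂ν := by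
        gcongr with s
        rw [lintegral_mul_const _ (hK.of_uncurry_right)]
        gcongr
        exact h₂ s
    _ = A ^ p * ∫⁻ s, h s ^ p ∂ν := by
        rw [lintegral_const_mul' _ _ hA, ← mul_assoc]
        congr 1
        conv_rhs => rw [← hpq1]
        rw [ENNReal.rpow_add_of_nonneg _ _ (by positivity) zero_le_one, ENNReal.rpow_one]

theorem lintegral_exp_mul_Iic {a : ℝ} (ha : 0 < a) (t : ℝ) :
    ∫⁻ s in Iic t, ENNReal.ofReal (Real.exp (a * s)) = ENNReal.ofReal (Real.exp (a * t) / a) := by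
  rw [← integral_exp_mul_Iic ha, ofReal_integral_eq_lintegral_ofReal
    (integrableOn_exp_mul_Iic ha t) (Filter.Eventually.of_forall fun _ => (Real.exp_pos _).le)]

theorem lintegral_exp_mul_Ici {a : ℝ} (ha : a < 0) (t : ℝ) :
    ∫⁻ s in Ici t, ENNReal.ofReal (Real.exp (a * s)) = ENNReal.ofReal (-Real.exp (a * t) / a) := by
  rw [← integral_exp_mul_Ioi ha, setLIntegral_congr Ioi_ae_eq_Ici.symm,
    ofReal_integral_eq_lintegral_ofReal
    (integrableOn_exp_mul_Ioi ha t) (Filter.Eventually.of_forall fun _ => (Real.exp_pos _).le)]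

variable {F : Type*} [NormedAddCommGroup F] [NormedSpace ℝ F]

/-- The primitive of `w` that vanishes at `-∞`. -/
def prim (w : ℝ → F) (t : ℝ) : F := ∫ s in Iic t, w s

/-- The function `t ↦ exp (-δ t) w(t)`. -/
def weighted (δ : ℝ) (w : ℝ → F) (t : ℝ) : F := Real.exp (-δ * t) • w t

theorem enorm_weighted (δ : ℝ) (w : ℝ → F) (t : ℝ) :
    ‖weighted δ w t‖ₑ = ENNReal.ofReal (Real.exp (-δ * t)) * ‖w t‖ₑ := by
  rw [weighted, enorm_smul, Real.enorm_eq_ofReal (Real.exp_pos _).le]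

theorem aestronglyMeasurable_weighted {δ : ℝ} {w : ℝ → F} {μ : Measure ℝ}
    (hw : AEStronglyMeasurable w μ) : AEStronglyMeasurable (weighted δ w) μ :=
  (Continuous.aestronglyMeasurable (by fun_prop)).smul hw

theorem weighted_neg_weighted (δ : ℝ) (w : ℝ → F) : weighted (-δ) (weighted δ w) = w := by
  funext t
  simp only [weighted, smul_smul, ← Real.exp_add]
  simp

theorem aestronglyMeasurable_of_weighted {δ : ℝ} {w : ℝ → F} {μ : Measure ℝ}
    (hw : AEStronglyMeasurable (weighted δ w) μ) : AEStronglyMeasurable w μ := by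
  rw [← weighted_neg_weighted δ w]
  exact aestronglyMeasurable_weighted hw

/-- **Hardy's inequality** with exponential weights. -/
theorem eLpNorm_weighted_prim_le {p δ : ℝ} (hp : 1 < p) (hδ : 0 < δ) {w : ℝ → F}
    (hw : AEStronglyMeasurable w) :
    eLpNorm (weighted δ (prim w)) (ENNReal.ofReal p) volume
      ≤ ENNReal.ofReal (1 / δ) * eLpNorm (weighted δ w) (ENNReal.ofReal p) volume := by
  have hp0 : 0 < p := by linarith
  have hp1 : ENNReal.ofReal p ≠ 0 := by simpa using hp0
  rw [eLpNorm_eq_lintegral_rpow_enorm_toReal hp1 ENNReal.ofReal_ne_top,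
    eLpNorm_eq_lintegral_rpow_enorm_toReal hp1 ENNReal.ofReal_ne_top,
    ENNReal.toReal_ofReal hp0.le]
  -- Conjugating integration over `s ≤ t` by the weight gives the kernel `exp (-δ (t - s))`, whose
  -- rows and columns all have mass `1 / δ`.
  set K : ℝ → ℝ → ℝ≥0∞ := fun t s =>
    {z : ℝ × ℝ | z.2 ≤ z.1}.indicator
      (fun z => ENNReal.ofReal (Real.exp (-δ * (z.1 - z.2)))) (t, s) with hKdef
  have hK : Measurable (Function.uncurry K) :=
    Measurable.indicator (by fun_prop) (measurableSet_le measurable_snd measurable_fst)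
  have hK1 : ∀ t s, K t s = (Iic t).indicator
      (fun s => ENNReal.ofReal (Real.exp (-δ * (t - s)))) s := fun t s => by
    simp [hKdef, indicator]
  have hK2 : ∀ t s, K t s = (Ici s).indicator
      (fun t => ENNReal.ofReal (Real.exp (-δ * (t - s)))) t := fun t s => by
    simp [hKdef, indicator]
  have h₁ : ∀ t, ∫⁻ s, K t s ≤ ENNReal.ofReal (1 / δ) := fun t => by
    simp_rw [hK1]
    rw [lintegral_indicator measurableSet_Iic]
    have : ∀ s, ENNReal.ofReal (Real.exp (-δ * (t - s))) =
        ENNReal.ofReal (Real.exp (-δ * t)) * ENNReal.ofReal (Real.exp (δ * s)) := fun s => by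
      rw [← ENNReal.ofReal_mul (Real.exp_pos _).le, ← Real.exp_add]; ring_nf
    simp_rw [this]
    rw [lintegral_const_mul' _ _ ENNReal.ofReal_ne_top, lintegral_exp_mul_Iic hδ,
      ← ENNReal.ofReal_mul (Real.exp_pos _).le, ← mul_div_assoc, ← Real.exp_add]
    simp
  have h₂ : ∀ s, ∫⁻ t, K t s ≤ ENNReal.ofReal (1 / δ) := fun s => by
    simp_rw [hK2]
    rw [lintegral_indicator measurableSet_Ici]
    have : ∀ t, ENNReal.ofReal (Real.exp (-δ * (t - s))) =
        ENNReal.ofReal (Real.exp (δ * s)) * ENNReal.ofReal (Real.exp (-δ * t)) := fun s => by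
      rw [← ENNReal.ofReal_mul (Real.exp_pos _).le, ← Real.exp_add]; ring_nf
    simp_rw [this]
    rw [lintegral_const_mul' _ _ ENNReal.ofReal_ne_top, lintegral_exp_mul_Ici (by linarith),
      ← ENNReal.ofReal_mul (Real.exp_pos _).le, neg_div_neg_eq, ← mul_div_assoc, ← Real.exp_add]
    simp
  have hS := lintegral_kernel_rpow_le hp hK (aestronglyMeasurable_weighted (δ := δ) hw).enorm
    ENNReal.ofReal_ne_top h₁ h₂
  have hpt : ∀ t, ‖weighted δ (prim w) t‖ₑ ≤ ∫⁻ s, K t s * ‖weighted δ w s‖ₑ := fun t => by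
    have : ∀ s, K t s * ‖weighted δ w s‖ₑ
        = (Iic t).indicator (fun s => ENNReal.ofReal (Real.exp (-δ * t)) * ‖w s‖ₑ) s := fun s => by
      rw [hK1]
      by_cases hs : s ∈ Iic t
      · rw [indicator_of_mem hs, indicator_of_mem hs, enorm_weighted, ← mul_assoc,
          ← ENNReal.ofReal_mul (Real.exp_pos _).le, ← Real.exp_add]
        ring_nf
      · rw [indicator_of_notMem hs, indicator_of_notMem hs, zero_mul]
    simp_rw [this]
    rw [lintegral_indicator measurableSet_Iic, lintegral_const_mul' _ _ ENNReal.ofReal_ne_top,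
      enorm_weighted]
    gcongr
    exact enorm_integral_le_lintegral_enorm _
  calc (∫⁻ t, ‖weighted δ (prim w) t‖ₑ ^ p) ^ (1 / p)
      ≤ (ENNReal.ofReal (1 / δ) ^ p * ∫⁻ s, ‖weighted δ w s‖ₑ ^ p) ^ (1 / p) := by
        gcongr
        refine le_trans (lintegral_mono fun t => ?_) hS
        gcongr
        exact hpt t
    _ = _ := by
        rw [ENNReal.mul_rpow_of_nonneg _ _ (by positivity), ← ENNReal.rpow_mul,
          mul_one_div_cancel hp0.ne', ENNReal.rpow_one]

theorem weighted_indicator (δ : ℝ) (s : Set ℝ) (w : ℝ → F) :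
    weighted δ (s.indicator w) = s.indicator (weighted δ w) := by
  funext t
  by_cases h : t ∈ s <;> simp [weighted, h]

/-- For `t ≤ 0` only the values of `w` on `(-∞, 0]` enter `prim w t`, so extension by zero reduces
this to the whole line. -/
theorem eLpNorm_weighted_prim_restrict_le {p δ : ℝ} (hp : 1 < p) (hδ : 0 < δ) {w : ℝ → F}
    (hw : AEStronglyMeasurable w (volume.restrict (Iic 0))) :
    eLpNorm (weighted δ (prim w)) (ENNReal.ofReal p) (volume.restrict (Iic 0))
      ≤ ENNReal.ofReal (1 / δ)
        * eLpNorm (weighted δ w) (ENNReal.ofReal p) (volume.restrict (Iic 0)) := by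
  have h := eLpNorm_weighted_prim_le hp hδ
    ((aestronglyMeasurable_indicator_iff measurableSet_Iic).2 hw)
  rw [weighted_indicator, eLpNorm_indicator_eq_eLpNorm_restrict measurableSet_Iic] at h
  refine le_trans (le_of_eq ?_)
    ((eLpNorm_mono_measure _ (Measure.restrict_le_self (s := Iic 0))).trans h)
  refine eLpNorm_congr_ae ((ae_restrict_iff' measurableSet_Iic).2
    (Filter.Eventually.of_forall fun t ht => ?_))
  simp only [weighted, prim]
  congr 1
  refine setIntegral_congr_fun measurableSet_Iic fun s hs => ?_
  rw [indicator_of_mem]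
  exact mem_Iic.2 ((mem_Iic.1 hs).trans (mem_Iic.1 ht))

/-- Hölder's inequality against the exponential weight. -/
theorem lintegral_Iic_le_of_weighted {p δ : ℝ} (hp : 1 < p) (hδ : 0 < δ) {w : ℝ → F} (t : ℝ)
    (hw : AEStronglyMeasurable w (volume.restrict (Iic t))) :
    ∫⁻ s in Iic t, ‖w s‖ₑ ≤
      ENNReal.ofReal (Real.exp (δ * p.conjExponent * t) / (δ * p.conjExponent))
          ^ (1 / p.conjExponent)
        * eLpNorm (weighted δ w) (ENNReal.ofReal p) (volume.restrict (Iic t)) := by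
  have hpq := Real.HolderConjugate.conjExponent hp
  set q := p.conjExponent
  have hp0 : 0 < p := hpq.pos
  have hq0 : 0 < q := hpq.symm.pos
  rw [eLpNorm_eq_lintegral_rpow_enorm_toReal (by simpa using hp0) ENNReal.ofReal_ne_top,
    ENNReal.toReal_ofReal hp0.le]
  have hH := ENNReal.lintegral_mul_le_Lp_mul_Lq (volume.restrict (Iic t)) hpq.symm
      (f := fun s => ENNReal.ofReal (Real.exp (δ * s))) (g := fun s => ‖weighted δ w s‖ₑ)
      (by fun_prop) (aestronglyMeasurable_weighted hw).enorm
  have e1 : ∀ s, ENNReal.ofReal (Real.exp (δ * s)) * ‖weighted δ w s‖ₑ = ‖w s‖ₑ := fun s => by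
    rw [enorm_weighted, ← mul_assoc, ← ENNReal.ofReal_mul (Real.exp_pos _).le, ← Real.exp_add]
    simp
  have e2 : ∀ s, ENNReal.ofReal (Real.exp (δ * s)) ^ q
      = ENNReal.ofReal (Real.exp (δ * q * s)) := fun s => by
    rw [ENNReal.ofReal_rpow_of_pos (Real.exp_pos _), ← Real.exp_mul]
    ring_nf
  simp only [Pi.mul_apply, e1, e2] at hH
  rwa [lintegral_exp_mul_Iic (by positivity)] at hH

/-- At `t = 0` the Hölder constant is `(1 / (δ q))^{1/q}`, which is at most 1 once `δ ≥ 1`. This is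
what makes later constants independent of `δ`. -/
theorem lintegral_Iic_zero_le_of_weighted {p δ : ℝ} (hp : 1 < p) (hδ : 1 ≤ δ) {w : ℝ → F}
    (hw : AEStronglyMeasurable w (volume.restrict (Iic 0))) :
    ∫⁻ s in Iic 0, ‖w s‖ₑ ≤
      eLpNorm (weighted δ w) (ENNReal.ofReal p) (volume.restrict (Iic 0)) := by
  have hpq := Real.HolderConjugate.conjExponent hp
  refine (lintegral_Iic_le_of_weighted hp (by linarith) 0 hw).trans ?_
  conv_rhs => rw [← one_mul (eLpNorm _ _ _)]
  gcongr
  refine ENNReal.rpow_le_one ?_ (by have := hpq.symm.pos; positivity)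
  rw [ENNReal.ofReal_le_one, mul_zero, Real.exp_zero]
  have := hpq.symm.lt
  rw [div_le_one (by positivity)]
  nlinarith

theorem integrableOn_Iic_of_weighted {p δ : ℝ} (hp : 1 < p) (hδ : 0 < δ) {w : ℝ → F} (t : ℝ)
    (hw : MemLp (weighted δ w) (ENNReal.ofReal p) (volume.restrict (Iic t))) :
    IntegrableOn w (Iic t) := by
  have hpq := Real.HolderConjugate.conjExponent hp
  have hm := aestronglyMeasurable_of_weighted hw.1
  refine ⟨hm, (lintegral_Iic_le_of_weighted hp hδ t hm).trans_lt ?_⟩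
  refine ENNReal.mul_lt_top (ENNReal.rpow_lt_top_of_nonneg ?_ ENNReal.ofReal_ne_top) hw.2
  have := hpq.symm.pos
  positivity

theorem prim_eq_add_intervalIntegral {w : ℝ → F} (hw : ∀ t, IntegrableOn w (Iic t)) (a t : ℝ) :
    prim w t = prim w a + ∫ s in a..t, w s := by
  rw [← intervalIntegral.integral_Iic_sub_Iic (hw a) (hw t)]
  simp [prim]

theorem continuous_prim {w : ℝ → F} (hw : ∀ t, IntegrableOn w (Iic t)) : Continuous (prim w) := by
  have : prim w = fun t => prim w 0 + ∫ s in (0 : ℝ)..t, w s :=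
    funext fun t => prim_eq_add_intervalIntegral hw 0 t
  rw [this]
  refine continuous_const.add (intervalIntegral.continuous_primitive (fun a b => ?_) 0)
  exact intervalIntegrable_iff.2 ((hw (max a b)).mono_set fun s hs => hs.2)

end

/-! ### Test functions and weak derivatives on the half line. -/

section
variable {F : Type*} [NormedAddCommGroup F] [NormedSpace ℝ F]

/-- Test functions on the open half line. -/
structure IsTest (φ : ℝ → ℝ) : Prop where
  smooth : ContDiff ℝ ∞ φ
  compact : HasCompactSupport φ
  supp : tsupport φ ⊆ Iio 0

theorem IsTest.deriv {φ : ℝ → ℝ} (h : IsTest φ) : IsTest (deriv φ) :=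
  ⟨(contDiff_infty_iff_deriv.1 h.smooth).2, h.compact.deriv, tsupport_deriv_subset.trans h.supp⟩

theorem IsTest.iteratedDeriv {φ : ℝ → ℝ} (h : IsTest φ) (j : ℕ) : IsTest (iteratedDeriv j φ) := by
  induction j with
  | zero => simpa using h
  | succ j ih => rw [iteratedDeriv_succ]; exact ih.deriv

theorem IsTest.eq_zero {φ : ℝ → ℝ} (h : IsTest φ) {t : ℝ} (ht : t ∉ Iio (0 : ℝ)) : φ t = 0 :=
  image_eq_zero_of_notMem_tsupport fun h' => ht (h.supp h')

theorem IsTest.setIntegral_smul {φ : ℝ → ℝ} (h : IsTest φ) (v : ℝ → F) :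
    ∫ t in Iio (0 : ℝ), φ t • v t = ∫ t, φ t • v t :=
  setIntegral_eq_integral_of_forall_compl_eq_zero fun t ht => by rw [h.eq_zero ht, zero_smul]

theorem IsTest.integrable_smul {φ : ℝ → ℝ} (h : IsTest φ) {v : ℝ → F}
    (hv : LocallyIntegrableOn v (Iio 0)) : Integrable fun t => φ t • v t := by
  refine (integrableOn_iff_integrable_of_support_subset (s := tsupport φ) fun t ht => ?_).1
    ((hv.integrableOn_compact_subset h.supp h.compact).continuousOn_smul
      h.smooth.continuous.continuousOn h.compact)
  exact subset_tsupport _ fun h0 => ht (by simp [h0])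

theorem IsTest.integrable {φ : ℝ → ℝ} (h : IsTest φ) : Integrable φ :=
  h.smooth.continuous.integrable_of_hasCompactSupport h.compact

/-- Fubini on the triangle `s ≤ t`: the inner integral of `φ'` over `[s, ∞)` is `-φ s`. No
continuity of `w` is needed. -/
theorem IsTest.integral_deriv_smul_prim [CompleteSpace F] {φ : ℝ → ℝ} (h : IsTest φ) {w : ℝ → F}
    (hw : IntegrableOn w (Iic 0)) :
    ∫ t, _root_.deriv φ t • prim w t = -∫ t, φ t • w t := by
  set μ := (volume : Measure ℝ).restrict (Iic 0)
  have hms : MeasurableSet {z : ℝ × ℝ | z.2 ≤ z.1} := measurableSet_le measurable_snd measurable_fst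
  have hint : Integrable (Function.uncurry fun t s : ℝ =>
      {z : ℝ × ℝ | z.2 ≤ z.1}.indicator (fun z => _root_.deriv φ z.1 • w z.2) (t, s))
      ((volume : Measure ℝ).prod μ) := by
    have : Integrable (fun z : ℝ × ℝ => _root_.deriv φ z.1 • w z.2)
        ((volume : Measure ℝ).prod μ) := h.deriv.integrable.smul_prod hw
    exact this.indicator hms
  have h1 : ∀ t, _root_.deriv φ t • prim w t = ∫ s, {z : ℝ × ℝ | z.2 ≤ z.1}.indicator
      (fun z => _root_.deriv φ z.1 • w z.2) (t, s) ∂μ := by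
    intro t
    by_cases ht : t ∈ Iio (0 : ℝ)
    · have e : ∀ s, {z : ℝ × ℝ | z.2 ≤ z.1}.indicator (fun z => _root_.deriv φ z.1 • w z.2) (t, s)
          = (Iic t).indicator (fun s => _root_.deriv φ t • w s) s := fun s => by simp [indicator]
      simp_rw [e]
      rw [integral_indicator measurableSet_Iic, Measure.restrict_restrict measurableSet_Iic,
        Iic_inter_Iic, min_eq_left (le_of_lt ht), integral_smul, prim]
    · have e : ∀ s, {z : ℝ × ℝ | z.2 ≤ z.1}.indicator (fun z => _root_.deriv φ z.1 • w z.2) (t, s)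
          = 0 := fun s => by simp [indicator, h.deriv.eq_zero ht]
      simp_rw [e]
      simp [h.deriv.eq_zero ht]
  have h2 : ∀ s, ∫ t, {z : ℝ × ℝ | z.2 ≤ z.1}.indicator
      (fun z => _root_.deriv φ z.1 • w z.2) (t, s) = -(φ s • w s) := by
    intro s
    have e : ∀ t, {z : ℝ × ℝ | z.2 ≤ z.1}.indicator (fun z => _root_.deriv φ z.1 • w z.2) (t, s)
          = (Ici s).indicator (fun t => _root_.deriv φ t • w s) t := fun t => by simp [indicator]
    simp_rw [e]
    rw [integral_indicator measurableSet_Ici, integral_smul_const, integral_Ici_eq_integral_Ioi,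
      h.compact.integral_Ioi_deriv_eq (h.smooth.of_le (by exact_mod_cast le_top)), neg_smul]
  simp_rw [h1]
  rw [integral_integral_swap hint]
  simp_rw [h2]
  rw [integral_neg]
  congr 1
  refine setIntegral_eq_integral_of_forall_compl_eq_zero fun t ht => ?_
  rw [h.eq_zero fun h' => ht (mem_Iic.2 (mem_Iio.1 h').le), zero_smul]

theorem exists_isTest_integral_eq_one : ∃ η : ℝ → ℝ, IsTest η ∧ ∫ t, η t = 1 := by
  let b : ContDiffBump (-2 : ℝ) := ⟨1 / 2, 1, by norm_num, by norm_num⟩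
  refine ⟨b.normed volume, ⟨b.contDiff_normed, b.hasCompactSupport_normed, ?_⟩, b.integral_normed⟩
  rw [b.tsupport_normed_eq]
  intro t ht
  rw [Real.closedBall_eq_Icc] at ht
  have : t ≤ -2 + 1 := ht.2
  simp only [mem_Iio]; linarith

/-- A test function of mean zero is the derivative of a test function. -/
theorem IsTest.exists_deriv_eq {χ : ℝ → ℝ} (h : IsTest χ) (h0 : ∫ t, χ t = 0) :
    ∃ ψ, IsTest ψ ∧ _root_.deriv ψ = χ := by
  obtain ⟨a, ha⟩ := h.compact.isCompact.bddBelow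
  obtain ⟨b, hb0, hb⟩ : ∃ b < (0 : ℝ), ∀ t ∈ tsupport χ, t ≤ b := by
    rcases (tsupport χ).eq_empty_or_nonempty with he | hne
    · exact ⟨-1, by norm_num, by simp [he]⟩
    · obtain ⟨b, hb, hb'⟩ := h.compact.isCompact.exists_isGreatest hne
      exact ⟨b, h.supp hb, fun t ht => hb' ht⟩
  have hi : ∀ t, IntegrableOn χ (Iic t) := fun t => h.integrable.integrableOn
  have hd : ∀ t, HasDerivAt (prim χ) (χ t) t := fun t => by
    have : prim χ = fun t => prim χ 0 + ∫ s in (0 : ℝ)..t, χ s :=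
      funext fun t => prim_eq_add_intervalIntegral hi 0 t
    rw [this]
    exact (h.smooth.continuous.integral_hasStrictDerivAt 0 t).hasDerivAt.const_add _
  have hder : _root_.deriv (prim χ) = χ := funext fun t => (hd t).deriv
  have hsub : Function.support (prim χ) ⊆ Icc a b := by
    intro t ht
    by_contra hn
    apply ht
    rw [mem_Icc, not_and_or, not_le, not_le] at hn
    rcases hn with hn | hn
    · refine setIntegral_eq_zero_of_forall_eq_zero fun s hs => ?_
      exact image_eq_zero_of_notMem_tsupport fun h' =>
        absurd (ha h') (not_le.2 (lt_of_le_of_lt hs hn))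
    -- To the right of the support the primitive equals the full integral, which is zero by
    -- hypothesis.
    · rw [← h0]
      refine setIntegral_eq_integral_of_forall_compl_eq_zero fun s hs => ?_
      refine image_eq_zero_of_notMem_tsupport fun h' => hs ?_
      exact (hb s h').trans hn.le
  refine ⟨prim χ, ⟨?_, ?_, ?_⟩, hder⟩
  · exact contDiff_infty_iff_deriv.2 ⟨fun t => (hd t).differentiableAt, by rw [hder]; exact h.smooth⟩
  · exact HasCompactSupport.of_support_subset_isCompact isCompact_Icc hsub
  · exact (closure_minimal hsub isClosed_Icc).trans fun t ht => lt_of_le_of_lt ht.2 hb0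

theorem ae_eq_zero_of_forall_isTest [CompleteSpace F] {f : ℝ → F}
    (hf : LocallyIntegrableOn f (Iio 0))
    (h : ∀ φ, IsTest φ → ∫ t, φ t • f t = 0) : f =ᵐ[volume.restrict (Iic 0)] 0 := by
  rw [← restrict_Iio_eq_restrict_Iic]
  exact (ae_restrict_iff' measurableSet_Iio).2
    (isOpen_Iio.ae_eq_zero_of_integral_contDiff_smul_eq_zero hf
      fun g hg hg' hg'' => h g ⟨hg, hg', hg''⟩)

/-- The lemma of du Bois-Reymond. -/
theorem exists_ae_eq_const_of_forall_isTest [CompleteSpace F] {f : ℝ → F}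
    (hf : LocallyIntegrableOn f (Iio 0))
    (h : ∀ φ, IsTest φ → ∫ t, deriv φ t • f t = 0) :
    ∃ c : F, f =ᵐ[volume.restrict (Iic 0)] fun _ => c := by
  obtain ⟨η, hη, hη1⟩ := exists_isTest_integral_eq_one
  have hc : ∀ c : F, LocallyIntegrableOn (fun _ : ℝ => c) (Iio 0) := fun c =>
    continuousOn_const.locallyIntegrableOn measurableSet_Iio
  refine ⟨∫ t, η t • f t, ?_⟩
  set c := ∫ t, η t • f t
  have : (f - fun _ => c) =ᵐ[volume.restrict (Iic 0)] 0 := by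
    refine ae_eq_zero_of_forall_isTest (hf.sub (hc c)) fun φ hφ => ?_
    -- Subtracting the multiple of `η` makes the mean zero, so this is a derivative and the
    -- hypothesis applies; rearranging shows that `f - c` annihilates `φ`.
    have hχ : IsTest fun t => φ t - (∫ s, φ s) * η t := by
      refine ⟨hφ.smooth.sub (contDiff_const.mul hη.smooth), hφ.compact.sub hη.compact.mul_left, ?_⟩
      refine (tsupport_sub _ _).trans (union_subset hφ.supp ?_)
      exact (tsupport_mul_subset_right).trans hη.supp
    obtain ⟨ψ, hψ, hψ'⟩ := hχ.exists_deriv_eq (by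
      rw [integral_sub hφ.integrable (hη.integrable.const_mul _), integral_const_mul, hη1]; simp)
    have h1 := h ψ hψ
    rw [hψ'] at h1
    have e1 : ∀ t, (φ t - (∫ s, φ s) * η t) • f t = φ t • f t - (∫ s, φ s) • (η t • f t) :=
      fun t => by rw [sub_smul, mul_smul]
    simp_rw [e1] at h1
    rw [integral_sub (hφ.integrable_smul hf) ((hη.integrable_smul hf).fun_smul _), integral_smul] at h1
    simp only [Pi.sub_apply, smul_sub]
    rw [integral_sub (hφ.integrable_smul hf) (hφ.integrable_smul (hc c)), integral_smul_const]
    exact h1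
  filter_upwards [this] with t ht
  simpa [sub_eq_zero] using ht

variable {n : ℕ} {u u' v v' w : ℝ → E n} {j : ℕ}

theorem IsWeakDeriv.integral_eq (h : IsWeakDeriv j u v) {φ : ℝ → ℝ} (hφ : IsTest φ) :
    ∫ t, iteratedDeriv j φ t • u t = (-1 : ℝ) ^ j • ∫ t, φ t • v t := by
  rw [← hφ.setIntegral_smul, ← (hφ.iteratedDeriv j).setIntegral_smul]
  exact h.2.2 φ hφ.smooth hφ.compact hφ.supp

theorem isWeakDeriv_of_isTest (hu : LocallyIntegrableOn u (Iio 0))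
    (hv : LocallyIntegrableOn v (Iio 0))
    (h : ∀ φ, IsTest φ → ∫ t, iteratedDeriv j φ t • u t = (-1 : ℝ) ^ j • ∫ t, φ t • v t) :
    IsWeakDeriv j u v := by
  refine ⟨hu, hv, fun φ h1 h2 h3 => ?_⟩
  have hφ : IsTest φ := ⟨h1, h2, h3⟩
  rw [hφ.setIntegral_smul, (hφ.iteratedDeriv j).setIntegral_smul]
  exact h φ hφ

theorem IsWeakDeriv.ae_unique (h : IsWeakDeriv j u v) (h' : IsWeakDeriv j u v') :
    v =ᵐ[volume.restrict (Iic 0)] v' := by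
  have : (v - v') =ᵐ[volume.restrict (Iic 0)] 0 := by
    refine ae_eq_zero_of_forall_isTest (h.2.1.sub h'.2.1) fun φ hφ => ?_
    simp only [Pi.sub_apply, smul_sub]
    rw [integral_sub (hφ.integrable_smul h.2.1) (hφ.integrable_smul h'.2.1), sub_eq_zero]
    have := (h.integral_eq hφ).symm.trans (h'.integral_eq hφ)
    exact smul_right_injective _ (pow_ne_zero j (by norm_num)) this
  filter_upwards [this] with t ht
  simpa [sub_eq_zero] using ht

theorem IsWeakDeriv.sub (h : IsWeakDeriv j u v) (h' : IsWeakDeriv j u' v') :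
    IsWeakDeriv j (u - u') (v - v') := by
  refine isWeakDeriv_of_isTest (h.1.sub h'.1) (h.2.1.sub h'.2.1) fun φ hφ => ?_
  simp only [Pi.sub_apply, smul_sub]
  rw [integral_sub (hφ.integrable_smul h.2.1) (hφ.integrable_smul h'.2.1),
    integral_sub ((hφ.iteratedDeriv j).integrable_smul h.1)
      ((hφ.iteratedDeriv j).integrable_smul h'.1), smul_sub, h.integral_eq hφ, h'.integral_eq hφ]

theorem LocallyIntegrableOn.congr_Iic (hu : LocallyIntegrableOn u (Iio 0))
    (h : u =ᵐ[volume.restrict (Iic 0)] u') : LocallyIntegrableOn u' (Iio 0) := by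
  rw [← restrict_Iio_eq_restrict_Iic] at h
  exact MeasureTheory.LocallyIntegrableOn.congr h hu

theorem IsTest.integral_congr {φ : ℝ → ℝ} (hφ : IsTest φ)
    (h : u =ᵐ[volume.restrict (Iic 0)] u') : ∫ t, φ t • u t = ∫ t, φ t • u' t := by
  rw [← restrict_Iio_eq_restrict_Iic] at h
  rw [← hφ.setIntegral_smul, ← hφ.setIntegral_smul]
  refine integral_congr_ae ?_
  filter_upwards [h] with t ht
  rw [ht]

theorem IsWeakDeriv.congr (h : IsWeakDeriv j u v) (hu : u =ᵐ[volume.restrict (Iic 0)] u')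
    (hv : v =ᵐ[volume.restrict (Iic 0)] v') : IsWeakDeriv j u' v' := by
  refine isWeakDeriv_of_isTest (LocallyIntegrableOn.congr_Iic h.1 hu)
    (LocallyIntegrableOn.congr_Iic h.2.1 hv) fun φ hφ => ?_
  rw [← hφ.integral_congr hv, ← (hφ.iteratedDeriv j).integral_congr hu, h.integral_eq hφ]

theorem isWeakDeriv_zero (hu : LocallyIntegrableOn u (Iio 0)) : IsWeakDeriv 0 u u :=
  isWeakDeriv_of_isTest hu hu fun φ _ => by simp

/-- The half line has infinite measure. This removes the constant left by the du Bois-Reymond lemma,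
so the primitive is the one vanishing at `-∞`. -/
theorem eq_zero_of_integrableOn_const_Iic {X : Type*} [NormedAddCommGroup X] {c : X} (h : IntegrableOn (fun _ : ℝ => c) (Iic 0)) : c = 0 := by
  rcases (integrableOn_const_iff (by simp)).1 h with h | h
  · simpa using h
  · simp at h

/-- Consecutive weak derivatives with exponential decay are primitives of each other. -/
theorem IsWeakDeriv.ae_eq_prim (h : IsWeakDeriv j u v) (h' : IsWeakDeriv (j + 1) u v')
    {p δ : ℝ} (hp : 1 < p) (hδ : 0 < δ)
    (hv : MemLp (weighted δ v) (ENNReal.ofReal p) (volume.restrict (Iic 0)))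
    (hv' : MemLp (weighted δ v') (ENNReal.ofReal p) (volume.restrict (Iic 0))) :
    v =ᵐ[volume.restrict (Iic 0)] prim v' := by
  have hi' := integrableOn_Iic_of_weighted hp hδ 0 hv'
  have hi := integrableOn_Iic_of_weighted hp hδ 0 hv
  have hcont : ContinuousOn (prim v') (Iic 0) := by
    have hc := continuous_prim (w := (Iic (0 : ℝ)).indicator v') fun t =>
      ((integrable_indicator_iff measurableSet_Iic).2 hi').integrableOn
    refine hc.continuousOn.congr fun t ht => ?_
    refine setIntegral_congr_fun measurableSet_Iic fun s hs => ?_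
    rw [indicator_of_mem (mem_Iic.2 ((mem_Iic.1 hs).trans (mem_Iic.1 ht)))]
  have hprim : MemLp (weighted δ (prim v')) (ENNReal.ofReal p) (volume.restrict (Iic 0)) :=
    ⟨aestronglyMeasurable_weighted (hcont.aestronglyMeasurable measurableSet_Iic),
      (eLpNorm_weighted_prim_restrict_le hp hδ (aestronglyMeasurable_of_weighted hv'.1)).trans_lt
        (ENNReal.mul_lt_top ENNReal.ofReal_lt_top hv'.2)⟩
  have hip := integrableOn_Iic_of_weighted hp hδ 0 hprim
  have hlp : LocallyIntegrableOn (prim v') (Iio 0) :=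
    (hip.mono_set Iio_subset_Iic_self).locallyIntegrableOn
  -- Testing with `φ'` moves from order `j` to order `j + 1`, so `v` and `prim v'` have the same
  -- weak derivative and differ by a constant.
  obtain ⟨c, hc⟩ := exists_ae_eq_const_of_forall_isTest (h.2.1.sub hlp) fun φ hφ => by
    simp only [Pi.sub_apply, smul_sub]
    rw [integral_sub (hφ.deriv.integrable_smul h.2.1) (hφ.deriv.integrable_smul hlp),
      hφ.integral_deriv_smul_prim hi']
    have h1 := h.integral_eq hφ.deriv
    rw [← iteratedDeriv_succ', h'.integral_eq hφ, pow_succ, mul_smul] at h1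
    rw [← smul_right_injective _ (pow_ne_zero j (by norm_num)) h1]
    simp
  have hc0 : c = 0 := eq_zero_of_integrableOn_const_Iic ((hi.sub hip).congr_fun_ae hc)
  filter_upwards [hc] with t ht
  simpa [hc0, sub_eq_zero] using ht

/-- Integration by parts, one derivative at a time; compact support of the test function removes the
boundary terms. -/
theorem ContDiff.isWeakDeriv_iteratedDeriv {H : ℝ → E n} (hH : ContDiff ℝ j H) :
    IsWeakDeriv j H (iteratedDeriv j H) := by
  have hloc : ∀ {G : ℝ → E n}, Continuous G → LocallyIntegrableOn G (Iio 0) := fun hG =>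
    hG.continuousOn.locallyIntegrableOn measurableSet_Iio
  refine isWeakDeriv_of_isTest (hloc hH.continuous) (hloc (hH.continuous_iteratedDeriv' j)) ?_
  induction j generalizing H with
  | zero => intro φ _; simp
  | succ j ih =>
    intro φ hφ
    have hH' : ContDiff ℝ j (deriv H) :=
      (contDiff_succ_iff_deriv.1 (by exact_mod_cast hH : ContDiff ℝ ((j : ℕ∞ω) + 1) H)).2.2
    have hHd : Differentiable ℝ H := hH.differentiable (by simp)
    have hψ := hφ.iteratedDeriv j
    have hibp := integral_bilinear_hasDerivAt_right_eq_neg_left_of_integrable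
      (L := (ContinuousLinearMap.lsmul ℝ ℝ : ℝ →L[ℝ] E n →L[ℝ] E n).flip)
      (u := H) (u' := deriv H) (v := iteratedDeriv j φ) (v' := iteratedDeriv (j + 1) φ)
      (fun t _ => (hHd t).hasDerivAt)
      (fun t _ => by
        rw [iteratedDeriv_succ]
        exact ((hψ.smooth.differentiable (by simp)) t).hasDerivAt)
      ((hφ.iteratedDeriv (j + 1)).integrable_smul (hloc hH.continuous))
      (hψ.integrable_smul (hloc hH'.continuous))
      (hψ.integrable_smul (hloc hH.continuous))
    simp only [ContinuousLinearMap.flip_apply, ContinuousLinearMap.lsmul_apply] at hibp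
    rw [hibp, ih hH' φ hφ, iteratedDeriv_succ', pow_succ]
    simp

end

/-! ### The weighted Sobolev space as a space of iterated primitives. -/

section

section Primitive
variable {F : Type*} [NormedAddCommGroup F] [NormedSpace ℝ F] {p δ : ℝ} {w w₁ w₂ : ℝ → F}

theorem integrableOn_Iic_of_memLp_weighted (hp : 1 < p) (hδ : 0 < δ)
    (hw : MemLp (weighted δ w) (ENNReal.ofReal p)) (t : ℝ) : IntegrableOn w (Iic t) :=
  integrableOn_Iic_of_weighted hp hδ t (hw.mono_measure Measure.restrict_le_self)

theorem memLp_weighted_prim (hp : 1 < p) (hδ : 0 < δ)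
    (hw : MemLp (weighted δ w) (ENNReal.ofReal p)) :
    MemLp (weighted δ (prim w)) (ENNReal.ofReal p) :=
  ⟨aestronglyMeasurable_weighted
      (continuous_prim (integrableOn_Iic_of_memLp_weighted hp hδ hw)).aestronglyMeasurable,
    (eLpNorm_weighted_prim_le hp hδ (aestronglyMeasurable_of_weighted hw.1)).trans_lt
      (ENNReal.mul_lt_top ENNReal.ofReal_lt_top hw.2)⟩

theorem memLp_weighted_prim_iterate (hp : 1 < p) (hδ : 0 < δ)
    (hw : MemLp (weighted δ w) (ENNReal.ofReal p)) (m : ℕ) :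
    MemLp (weighted δ (prim^[m] w)) (ENNReal.ofReal p) := by
  induction m with
  | zero => exact hw
  | succ m ih => rw [Function.iterate_succ_apply']; exact memLp_weighted_prim hp hδ ih

theorem hasDerivAt_prim [CompleteSpace F] (hw : ∀ t, IntegrableOn w (Iic t)) (hc : Continuous w)
    (t : ℝ) : HasDerivAt (prim w) (w t) t := by
  have : prim w = fun t => prim w 0 + ∫ s in (0 : ℝ)..t, w s :=
    funext fun t => prim_eq_add_intervalIntegral hw 0 t
  rw [this]
  exact (hc.integral_hasStrictDerivAt 0 t).hasDerivAt.const_add _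

theorem deriv_prim [CompleteSpace F] (hw : ∀ t, IntegrableOn w (Iic t)) (hc : Continuous w) :
    deriv (prim w) = w := funext fun t => (hasDerivAt_prim hw hc t).deriv

theorem contDiff_prim [CompleteSpace F] {m : ℕ} (hw : ∀ t, IntegrableOn w (Iic t))
    (hc : ContDiff ℝ m w) : ContDiff ℝ (m + 1 : ℕ) (prim w) := by
  have : ((m + 1 : ℕ) : ℕ∞ω) = (m : ℕ∞ω) + 1 := by push_cast; rfl
  rw [this, contDiff_succ_iff_deriv, deriv_prim hw hc.continuous]
  exact ⟨fun t => (hasDerivAt_prim hw hc.continuous t).differentiableAt,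
    fun h => by simp at h, hc⟩

/-- Since `w` is only in `L^p`, the first primitive yields continuity alone; each further one adds a
derivative. Hence `m + 1` primitives for class `C^m`. -/
theorem contDiff_prim_iterate [CompleteSpace F] (hp : 1 < p) (hδ : 0 < δ)
    (hw : MemLp (weighted δ w) (ENNReal.ofReal p)) (m : ℕ) : ContDiff ℝ m (prim^[m + 1] w) := by
  have hi := fun m => integrableOn_Iic_of_memLp_weighted hp hδ
    (memLp_weighted_prim_iterate hp hδ hw m)
  induction m with
  | zero => simpa [contDiff_zero] using continuous_prim (hi 0)
  | succ m ih => rw [Function.iterate_succ_apply']; exact contDiff_prim (hi _) ih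

theorem iteratedDeriv_prim_iterate [CompleteSpace F] (hp : 1 < p) (hδ : 0 < δ)
    (hw : MemLp (weighted δ w) (ENNReal.ofReal p)) (m i : ℕ) :
    iteratedDeriv i (prim^[m + 1 + i] w) = prim^[m + 1] w := by
  have hi := fun m => integrableOn_Iic_of_memLp_weighted hp hδ
    (memLp_weighted_prim_iterate hp hδ hw m)
  induction i with
  | zero => simp
  | succ i ih =>
    rw [iteratedDeriv_succ', ← add_assoc, Function.iterate_succ_apply', deriv_prim (hi _), ih]
    rw [show m + 1 + i = m + i + 1 by ring]
    exact (contDiff_prim_iterate hp hδ hw _).continuous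

theorem prim_sub (h₁ : ∀ t, IntegrableOn w₁ (Iic t)) (h₂ : ∀ t, IntegrableOn w₂ (Iic t)) :
    prim (w₁ - w₂) = prim w₁ - prim w₂ := by
  funext t
  exact integral_sub (h₁ t) (h₂ t)

theorem prim_congr_Iic (h : w₁ =ᵐ[volume.restrict (Iic 0)] w₂) {t : ℝ} (ht : t ≤ 0) :
    prim w₁ t = prim w₂ t :=
  integral_congr_ae (ae_mono (Measure.restrict_mono (Iic_subset_Iic.2 ht) le_rfl) h)

/-- The weighted `L^p` norm on the half line. -/
def lpNorm (p δ : ℝ) (w : ℝ → F) : ℝ≥0∞ :=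
  eLpNorm (weighted δ w) (ENNReal.ofReal p) (volume.restrict (Iic 0))

theorem lpNorm_congr (h : w₁ =ᵐ[volume.restrict (Iic 0)] w₂) : lpNorm p δ w₁ = lpNorm p δ w₂ := by
  refine eLpNorm_congr_ae ?_
  filter_upwards [h] with t ht
  simp [weighted, ht]

theorem lpNorm_prim_iterate_sub_le (hp : 1 < p) (hδ : 0 < δ)
    (h₁ : MemLp (weighted δ w₁) (ENNReal.ofReal p))
    (h₂ : MemLp (weighted δ w₂) (ENNReal.ofReal p)) (i : ℕ) :
    lpNorm p δ (prim^[i + 1] w₁ - prim^[i + 1] w₂)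
      ≤ ENNReal.ofReal (1 / δ) * lpNorm p δ (prim^[i] w₁ - prim^[i] w₂) := by
  have h₁' := memLp_weighted_prim_iterate hp hδ h₁ i
  have h₂' := memLp_weighted_prim_iterate hp hδ h₂ i
  rw [Function.iterate_succ_apply', Function.iterate_succ_apply',
    ← prim_sub (integrableOn_Iic_of_memLp_weighted hp hδ h₁')
      (integrableOn_Iic_of_memLp_weighted hp hδ h₂')]
  exact eLpNorm_weighted_prim_restrict_le hp hδ
    ((aestronglyMeasurable_of_weighted h₁'.1).sub
      (aestronglyMeasurable_of_weighted h₂'.1)).restrict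

/-- The Sobolev embedding into bounded functions, with constant 1 uniformly in `δ ≥ 1`. -/
theorem enorm_prim_le_lpNorm (hp : 1 < p) (hδ : 1 ≤ δ)
    (hw : AEStronglyMeasurable w (volume.restrict (Iic 0))) {t : ℝ} (ht : t ≤ 0) :
    ‖prim w t‖ₑ ≤ lpNorm p δ w :=
  (enorm_integral_le_lintegral_enorm _).trans
    ((lintegral_mono' (Measure.restrict_mono (Iic_subset_Iic.2 ht) le_rfl) le_rfl).trans
      (lintegral_Iic_zero_le_of_weighted hp hδ hw))

end Primitive

variable {n : ℕ} {p δ : ℝ} {k : ℕ} {u u₁ u₂ : ℝ → E n}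

/-- Weak derivatives are a.e. unique, so every candidate in the infimum has the same norm. -/
theorem wNorm_eq_sum {v : ℕ → ℝ → E n} (h : ∀ j ≤ k, IsWeakDeriv j u (v j)) :
    wNorm p k δ u = ∑ j ∈ Finset.range (k + 1), lpNorm p δ (v j) := by
  refine Finset.sum_congr rfl fun j hj => ?_
  have hj' := h j (Nat.lt_succ_iff.1 (Finset.mem_range.1 hj))
  refine le_antisymm (iInf₂_le (v j) hj') (le_iInf₂ fun v' hv' => ?_)
  exact (lpNorm_congr (hj'.ae_unique hv')).le

theorem exists_isWeakDeriv_of_wNorm_lt_top (h : wNorm p k δ u < ⊤) :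
    ∃ v : ℕ → ℝ → E n, ∀ j ≤ k, IsWeakDeriv j u (v j) := by
  have : ∀ j, ∃ v, j ≤ k → IsWeakDeriv j u v := by
    intro j
    -- Without a weak derivative the infimum is empty, hence `⊤`, and the sum cannot be finite.
    by_contra! hn
    have hj : j ∈ Finset.range (k + 1) := Finset.mem_range.2 (Nat.lt_succ_of_le (hn 0).1)
    have := (ENNReal.sum_lt_top.1 h) j hj
    simp only [(hn _).2, iInf_false, iInf_top, lt_self_iff_false] at this
  choose v hv using this
  exact ⟨v, hv⟩

/-- A function in the weighted Sobolev space is a `k`-fold primitive. -/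
theorem exists_prim_iterate_of_wNorm_lt_top (hp : 1 < p) (hδ : 0 < δ) (h : wNorm p k δ u < ⊤) :
    ∃ w : ℝ → E n, MemLp (weighted δ w) (ENNReal.ofReal p) ∧
      u =ᵐ[volume.restrict (Iic 0)] prim^[k] w ∧ ∀ j ≤ k, IsWeakDeriv j u (prim^[k - j] w) := by
  obtain ⟨v, hv⟩ := exists_isWeakDeriv_of_wNorm_lt_top h
  have hloc : ∀ j ≤ k, AEStronglyMeasurable (v j) (volume.restrict (Iic 0)) := fun j hj => by
    rw [← restrict_Iio_eq_restrict_Iic]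
    exact (hv j hj).2.1.aestronglyMeasurable
  have hmem : ∀ j ≤ k, MemLp (weighted δ (v j)) (ENNReal.ofReal p) (volume.restrict (Iic 0)) := by
    intro j hj
    refine ⟨aestronglyMeasurable_weighted (hloc j hj), ?_⟩
    rw [wNorm_eq_sum hv] at h
    exact (ENNReal.sum_lt_top.1 h) j (Finset.mem_range.2 (Nat.lt_succ_of_le hj))
  -- Extending the top derivative by zero makes all iterated primitives functions on `ℝ`, so that
  -- ordinary calculus applies to them.
  set w := (Iic (0 : ℝ)).indicator (v k) with hw
  have hae : ∀ i ≤ k, v (k - i) =ᵐ[volume.restrict (Iic 0)] prim^[i] w := by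
    intro i
    induction i with
    | zero =>
      intro _
      filter_upwards [ae_restrict_mem measurableSet_Iic] with t ht
      simp [hw, indicator_of_mem ht]
    | succ i ih =>
      intro hi
      have e : k - (i + 1) + 1 = k - i := by omega
      have h1 := (hv (k - (i + 1)) (by omega)).ae_eq_prim (by rw [e]; exact hv (k - i) (by omega))
        hp hδ (hmem _ (by omega)) (hmem _ (by omega))
      filter_upwards [h1, ae_restrict_mem measurableSet_Iic] with t ht ht0
      rw [ht, Function.iterate_succ_apply']
      exact prim_congr_Iic (ih (by omega)) ht0
  refine ⟨w, ?_, ?_, fun j hj => ?_⟩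
  · rw [hw, weighted_indicator]
    exact (memLp_indicator_iff_restrict measurableSet_Iic).2 (hmem k le_rfl)
  · have h0 := hae k le_rfl
    rw [Nat.sub_self] at h0
    refine ((isWeakDeriv_zero (hv 0 (Nat.zero_le _)).1).ae_unique (hv 0 (Nat.zero_le _))).trans h0
  · have h0 := hae (k - j) (Nat.sub_le _ _)
    rw [Nat.sub_sub_self hj] at h0
    exact (hv j hj).congr (Filter.EventuallyEq.refl _ _) h0

theorem lpNorm_prim_iterate_sub_le_wNorm {w₁ w₂ : ℝ → E n}
    (h₁ : ∀ j ≤ k, IsWeakDeriv j u₁ (prim^[k - j] w₁))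
    (h₂ : ∀ j ≤ k, IsWeakDeriv j u₂ (prim^[k - j] w₂)) {i : ℕ} (hi : i ≤ k) :
    lpNorm p δ (prim^[i] w₁ - prim^[i] w₂) ≤ wNorm p k δ (u₁ - u₂) := by
  rw [wNorm_eq_sum (v := fun j => prim^[k - j] w₁ - prim^[k - j] w₂)
    fun j hj => (h₁ j hj).sub (h₂ j hj)]
  have := Finset.single_le_sum (f := fun j => lpNorm p δ (prim^[k - j] w₁ - prim^[k - j] w₂))
    (fun _ _ => zero_le) (Finset.mem_range.2 (Nat.lt_succ_of_le (Nat.sub_le k i)))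
  rwa [Nat.sub_sub_self hi] at this

theorem lpNorm_prim_iterate_le_wNorm {w : ℝ → E n}
    (h : ∀ j ≤ k, IsWeakDeriv j u (prim^[k - j] w)) {i : ℕ} (hi : i ≤ k) :
    lpNorm p δ (prim^[i] w) ≤ wNorm p k δ u := by
  rw [wNorm_eq_sum h]
  have := Finset.single_le_sum (f := fun j => lpNorm p δ (prim^[k - j] w))
    (fun _ _ => zero_le) (Finset.mem_range.2 (Nat.lt_succ_of_le (Nat.sub_le k i)))
  rwa [Nat.sub_sub_self hi] at this

/-- For the derivatives of order below `k` the Sobolev ball of radius `r` gives the pointwise bound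
`r`. The top derivative (`i + 1 = 0`) is excluded. -/
theorem norm_prim_iterate_le {w : ℝ → E n} {r : ℝ} (hp : 1 < p) (hδ : 1 ≤ δ) (hr : 0 ≤ r)
    (hw : MemLp (weighted δ w) (ENNReal.ofReal p))
    (h : ∀ j ≤ k, IsWeakDeriv j u (prim^[k - j] w)) (hu : wNorm p k δ u ≤ ENNReal.ofReal r)
    {i : ℕ} (hi : i < k) {t : ℝ} (ht : t ≤ 0) : ‖prim^[i + 1] w t‖ ≤ r := by
  rw [Function.iterate_succ_apply']
  have h1 := enorm_prim_le_lpNorm hp hδ (aestronglyMeasurable_of_weighted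
    (memLp_weighted_prim_iterate hp (by linarith) hw i).1).restrict ht
  have h2 := (h1.trans (lpNorm_prim_iterate_le_wNorm h hi.le)).trans hu
  rwa [← ofReal_norm, ENNReal.ofReal_le_ofReal_iff hr] at h2

end

/-! ### Derivatives of compositions. -/

section

theorem iteratedDeriv_prodMk {X Y : Type*} [NormedAddCommGroup X] [NormedSpace ℝ X]
    [NormedAddCommGroup Y] [NormedSpace ℝ Y] {l : ℕ} {y : ℝ → X} {z : ℝ → Y}
    (hy : ContDiff ℝ l y) (hz : ContDiff ℝ l z) :
    iteratedDeriv l (fun t => (y t, z t)) = fun t => (iteratedDeriv l y t, iteratedDeriv l z t) := by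
  induction l with
  | zero => simp
  | succ l ih =>
    have hl : (l : ℕ∞ω) ≤ (l + 1 : ℕ) := by exact_mod_cast Nat.le_succ l
    have hl' : (l : ℕ∞ω) < (l + 1 : ℕ) := by exact_mod_cast Nat.lt_succ_self l
    funext t
    rw [iteratedDeriv_succ, ih (hy.of_le hl) (hz.of_le hl), iteratedDeriv_succ, iteratedDeriv_succ]
    exact ((hy.differentiable_iteratedDeriv l hl' t).hasDerivAt.prodMk
      (hz.differentiable_iteratedDeriv l hl' t).hasDerivAt).deriv

universe v

/-- The `j`-th derivative of `f ∘ y` is a locally Lipschitz function of the `j`-jet of `y`. -/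
theorem exists_norm_iteratedDeriv_comp_sub_le {G : Type*} [NormedAddCommGroup G] [NormedSpace ℝ G]
    (j : ℕ) {X : Type v} [NormedAddCommGroup X] [NormedSpace ℝ X] [FiniteDimensional ℝ X]
    {f : X → G} (hf : ContDiff ℝ ∞ f) (B : ℝ) :
    ∃ C : ℝ, 0 ≤ C ∧ ∀ y₁ y₂ : ℝ → X, ContDiff ℝ j y₁ → ContDiff ℝ j y₂ → ∀ t,
      (∀ l ≤ j, ‖iteratedDeriv l y₁ t‖ ≤ B) → (∀ l ≤ j, ‖iteratedDeriv l y₂ t‖ ≤ B) →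
      ‖iteratedDeriv j (f ∘ y₁) t - iteratedDeriv j (f ∘ y₂) t‖
        ≤ C * ∑ i ∈ Finset.range (j + 1), ‖iteratedDeriv i y₁ t - iteratedDeriv i y₂ t‖ := by
  induction j generalizing X with
  | zero =>
    obtain ⟨C, hC⟩ := (isCompact_closedBall (0 : X) B).exists_bound_of_continuousOn
      (hf.continuous_fderiv (by simp)).continuousOn
    refine ⟨max C 0, le_max_right _ _, fun y₁ y₂ _ _ t h₁ h₂ => ?_⟩
    have h₁' := h₁ 0 le_rfl
    have h₂' := h₂ 0 le_rfl
    simp only [iteratedDeriv_zero, zero_add, Finset.sum_range_one, Function.comp] at h₁' h₂' ⊢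
    exact (convex_closedBall (0 : X) B).norm_image_sub_le_of_norm_fderiv_le
      (fun x _ => (hf.differentiable (by simp)) x) (fun x hx => (hC x hx).trans (le_max_left _ _))
      (by simpa using h₂') (by simpa using h₁')
  | succ j ih =>
    -- Since `(f ∘ y)' = g ∘ (y, y')`, the induction replaces `f` by `g` and `X` by `X × X`; this
    -- avoids any explicit formula for higher chain rules.
    set g : X × X → G := fun z => fderiv ℝ f z.1 z.2
    have hgs : ContDiff ℝ ∞ g :=
      ((hf.fderiv_right (m := ∞) (by simp)).comp contDiff_fst).clm_apply contDiff_snd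
    obtain ⟨C, hC0, hC⟩ := ih hgs
    refine ⟨2 * C, by positivity, fun y₁ y₂ hy₁ hy₂ t h₁ h₂ => ?_⟩
    have hj : (j : ℕ∞ω) ≤ (j + 1 : ℕ) := by exact_mod_cast Nat.le_succ j
    have hder : ∀ {y : ℝ → X}, ContDiff ℝ (j + 1 : ℕ) y → ContDiff ℝ j (deriv y) := fun hy =>
      (contDiff_succ_iff_deriv.1 (by exact_mod_cast hy : ContDiff ℝ ((j : ℕ∞ω) + 1) _)).2.2
    have hcomp : ∀ {y : ℝ → X}, ContDiff ℝ (j + 1 : ℕ) y →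
        iteratedDeriv (j + 1) (f ∘ y) = iteratedDeriv j (g ∘ fun t => (y t, deriv y t)) := by
      intro y hy
      rw [iteratedDeriv_succ']
      congr 1
      funext s
      exact (((hf.differentiable (by simp)) (y s)).hasFDerivAt.comp_hasDerivAt s
        ((hy.differentiable (by simp)) s).hasDerivAt).deriv
    have hpair : ∀ {y : ℝ → X}, ContDiff ℝ (j + 1 : ℕ) y → ∀ l ≤ j,
        iteratedDeriv l (fun t => (y t, deriv y t)) t
          = (iteratedDeriv l y t, iteratedDeriv (l + 1) y t) := by
      intro y hy l hl
      have hl' : (l : ℕ∞ω) ≤ j := by exact_mod_cast hl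
      rw [iteratedDeriv_prodMk ((hy.of_le hj).of_le hl') ((hder hy).of_le hl'), iteratedDeriv_succ']
    have hbd : ∀ {y : ℝ → X}, ContDiff ℝ (j + 1 : ℕ) y →
        (∀ l ≤ j + 1, ‖iteratedDeriv l y t‖ ≤ B) →
        ∀ l ≤ j, ‖iteratedDeriv l (fun t => (y t, deriv y t)) t‖ ≤ B := by
      intro y hy h l hl
      rw [hpair hy l hl, Prod.norm_mk]
      exact max_le (h l (by omega)) (h (l + 1) (by omega))
    rw [hcomp hy₁, hcomp hy₂]
    refine (hC _ _ ((hy₁.of_le hj).prodMk (hder hy₁)) ((hy₂.of_le hj).prodMk (hder hy₂)) t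
      (hbd hy₁ h₁) (hbd hy₂ h₂)).trans ?_
    rw [mul_comm 2 C, mul_assoc]
    gcongr
    set d : ℕ → ℝ := fun i => ‖iteratedDeriv i y₁ t - iteratedDeriv i y₂ t‖
    have hd0 : ∀ i, 0 ≤ d i := fun i => norm_nonneg _
    calc ∑ i ∈ Finset.range (j + 1), ‖iteratedDeriv i (fun t => (y₁ t, deriv y₁ t)) t
            - iteratedDeriv i (fun t => (y₂ t, deriv y₂ t)) t‖
        ≤ ∑ i ∈ Finset.range (j + 1), (d i + d (i + 1)) := by
          refine Finset.sum_le_sum fun i hi => ?_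
          have hi' : i ≤ j := Nat.lt_succ_iff.1 (Finset.mem_range.1 hi)
          rw [hpair hy₁ i hi', hpair hy₂ i hi', Prod.mk_sub_mk, Prod.norm_mk]
          exact max_le (le_add_of_nonneg_right (hd0 _)) (le_add_of_nonneg_left (hd0 _))
      _ = ∑ i ∈ Finset.range (j + 1), d i + ∑ i ∈ Finset.range (j + 1), d (i + 1) :=
          Finset.sum_add_distrib
      -- Passing to the pair `(y, y')` counts each `d i` at most twice, whence the constant `2 * C`.
      _ ≤ 2 * ∑ i ∈ Finset.range (j + 1 + 1), d i := by
          have e1 := Finset.sum_range_succ d (j + 1)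
          have e2 := Finset.sum_range_succ' d (j + 1)
          have := hd0 0
          have := hd0 (j + 1)
          linarith

/-! ### Decay of derivatives by interpolation. -/

section Decay
variable {G : Type*} [NormedAddCommGroup G] [NormedSpace ℝ G]

/-- A Landau type inequality: decay of `g` and boundedness of `g''` give decay of `g'`. -/
theorem norm_deriv_le_of_norm_le_sq {g g' g'' : ℝ → G} (hg : ∀ t, HasDerivAt g (g' t) t)
    (hg' : ∀ t, HasDerivAt g' (g'' t) t) {A B : ℝ} {ρ : ℝ → ℝ} (hρ : Monotone ρ)
    (hρ0 : ∀ t, 0 < ρ t) (hA0 : 0 ≤ A) (hA : ∀ t ≤ 0, ‖g t‖ ≤ A * ρ t ^ 2)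
    (hB : ∀ t ≤ 0, ‖g'' t‖ ≤ B) {t : ℝ} (ht : t ≤ 0) : ‖g' t‖ ≤ (2 * A + B) * ρ t := by
  -- A backward step of length `ρ t` keeps `[t - h, t]` in `(-∞, 0]`. On it `h g'(t)` equals `g(t) -
  -- g(t - h)` up to `B h²`, and monotonicity of `ρ` bounds both values of `g` by `A h²`.
  set h := ρ t
  have hh : 0 < h := hρ0 t
  have hsub : ∀ τ ∈ Icc (t - h) t, τ ≤ 0 := fun τ hτ => hτ.2.trans ht
  have htm : t ∈ Icc (t - h) t := ⟨by linarith, le_rfl⟩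
  have hB0 : 0 ≤ B := (norm_nonneg _).trans (hB 0 le_rfl)
  have h1 : ∀ τ ∈ Icc (t - h) t, ‖g' τ - g' t‖ ≤ B * h := fun τ hτ => by
    refine ((convex_Icc (t - h) t).norm_image_sub_le_of_norm_hasDerivWithin_le
      (fun x _ => (hg' x).hasDerivWithinAt) (fun x hx => hB x (hsub x hx)) htm hτ).trans ?_
    gcongr
    rw [Real.norm_eq_abs, abs_le]
    constructor <;> linarith [hτ.1, hτ.2]
  have h2 : ‖(g (t - h) - (t - h) • g' t) - (g t - t • g' t)‖ ≤ B * h * ‖t - h - t‖ := by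
    refine (convex_Icc (t - h) t).norm_image_sub_le_of_norm_hasDerivWithin_le
      (f := fun τ => g τ - τ • g' t) (f' := fun τ => g' τ - g' t)
      (fun x _ => ?_) h1 htm ⟨le_rfl, by linarith⟩
    have := (hg x).sub ((hasDerivAt_id x).smul_const (g' t))
    rw [one_smul] at this
    exact this.hasDerivWithinAt
  have e : h • g' t = ((g (t - h) - (t - h) • g' t) - (g t - t • g' t)) - g (t - h) + g t := by
    module
  have h3 : h * ‖g' t‖ ≤ h * ((2 * A + B) * h) := by
    have hn : ‖t - h - t‖ = h := by
      rw [sub_sub_cancel_left, norm_neg, Real.norm_eq_abs, abs_of_pos hh]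
    rw [hn] at h2
    have h4 : ‖g (t - h)‖ ≤ A * h ^ 2 := by
      refine (hA (t - h) (by linarith)).trans ?_
      gcongr
      · exact (hρ0 _).le
      · exact hρ (by linarith)
    calc h * ‖g' t‖ = ‖h • g' t‖ := by rw [norm_smul, Real.norm_eq_abs, abs_of_pos hh]
      _ ≤ B * h * h + A * h ^ 2 + A * h ^ 2 := by
          rw [e]
          exact (norm_add_le _ _).trans (add_le_add ((norm_sub_le _ _).trans (add_le_add h2 h4))
            (hA t ht))
      _ = _ := by ring
  exact le_of_mul_le_mul_left h3 hh

/-- Each use of the Landau inequality costs half of the exponent of `ρ`, so starting from `2 ^ k` at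
least one power survives `k` steps. The constant grows by at most 3 per step, as `2 · 3^j (A + B) +
B ≤ 3^{j+1} (A + B)`. Bounding order `j + 1` uses order `j + 2`, hence the bounds up to `k + 1`. -/
theorem norm_iteratedDeriv_le_of_norm_le_pow {g : ℝ → G} (hg : ContDiff ℝ ∞ g) {A B : ℝ}
    {ρ : ℝ → ℝ} (hρ : Monotone ρ) (hρ0 : ∀ t, 0 < ρ t) (hρ1 : ∀ t ≤ 0, ρ t ≤ 1) {k : ℕ}
    (hA : ∀ t ≤ 0, ‖g t‖ ≤ A * ρ t ^ 2 ^ k)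
    (hB : ∀ j ≤ k + 1, ∀ t ≤ 0, ‖iteratedDeriv j g t‖ ≤ B) {j : ℕ} (hj : j ≤ k) {t : ℝ}
    (ht : t ≤ 0) : ‖iteratedDeriv j g t‖ ≤ 3 ^ j * (A + B) * ρ t := by
  have hB0 : 0 ≤ B := (norm_nonneg _).trans (hB 0 (Nat.zero_le _) 0 le_rfl)
  have hA0 : 0 ≤ A := nonneg_of_mul_nonneg_left ((norm_nonneg _).trans (hA 0 le_rfl))
    (pow_pos (hρ0 0) _)
  have hd : ∀ j t, HasDerivAt (iteratedDeriv j g) (iteratedDeriv (j + 1) g t) t := fun j t => by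
    rw [iteratedDeriv_succ]
    exact (hg.differentiable_iteratedDeriv j (by exact_mod_cast WithTop.coe_lt_top _) t).hasDerivAt
  have key : ∀ j ≤ k, ∀ t ≤ 0, ‖iteratedDeriv j g t‖ ≤ 3 ^ j * (A + B) * ρ t ^ 2 ^ (k - j) := by
    intro j
    induction j with
    | zero =>
      intro _ t ht
      have := hA t ht
      simp only [iteratedDeriv_zero, pow_zero, one_mul, Nat.sub_zero]
      refine this.trans (mul_le_mul_of_nonneg_right (by linarith) (pow_pos (hρ0 t) _).le)
    | succ j ih =>
      intro hj t ht
      have h := norm_deriv_le_of_norm_le_sq (hd j) (hd (j + 1)) (A := 3 ^ j * (A + B)) (B := B)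
        (ρ := fun t => ρ t ^ 2 ^ (k - (j + 1))) (fun a b hab => by
          have := hρ0 a
          have := hρ hab
          simp only; gcongr) (fun t => pow_pos (hρ0 t) _) (by positivity) (fun t ht => by
          rw [← pow_mul, ← pow_succ, show k - (j + 1) + 1 = k - j by omega]
          exact ih (by omega) t ht) (hB (j + 1 + 1) (by omega)) ht
      refine h.trans (mul_le_mul_of_nonneg_right ?_ (pow_pos (hρ0 t) _).le)
      have h3 : (1 : ℝ) ≤ 3 ^ j := one_le_pow₀ (by norm_num)
      rw [pow_succ]
      nlinarith
  refine (key j hj t ht).trans ?_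
  have : ρ t ^ 2 ^ (k - j) ≤ ρ t := pow_le_of_le_one (hρ0 t).le (hρ1 t ht) (by positivity)
  gcongr

end Decay

end

/-! ### The linear flow and the flat nonlinear part. -/

section
variable {n : ℕ}

/-- The standard form as a continuous linear map. -/
def standardFormL (lam : Fin n → ℝ) : E n →L[ℝ] E n :=
  LinearMap.toContinuousLinearMap
    { toFun := standardForm lam
      map_add' := fun x y => by ext i; simp [standardForm, mul_add]
      map_smul' := fun c x => by ext i; simp [standardForm, mul_left_comm] }

@[simp] theorem standardFormL_apply (lam : Fin n → ℝ) (x : E n) :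
    standardFormL lam x = standardForm lam x := rfl

theorem iteratedDeriv_standardFlow (lam : Fin n → ℝ) (x : E n) (l : ℕ) :
    iteratedDeriv l (fun t => standardFlow lam t x)
      = fun t => (standardFormL lam ^ l) (standardFlow lam t x) := by
  induction l with
  | zero => simp
  | succ l ih =>
    funext t
    rw [iteratedDeriv_succ, ih]
    have h := ((standardFormL lam ^ l).hasFDerivAt (x := standardFlow lam t x)).comp_hasDerivAt t
      ((standardFlow_spec lam x).2 t)
    rw [pow_succ]
    exact h.deriv

theorem contDiff_standardFlow (lam : Fin n → ℝ) (x : E n) :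
    ContDiff ℝ ∞ fun t => standardFlow lam t x := by
  rw [contDiff_euclidean]
  intro i
  simp only [standardFlow]
  fun_prop

theorem norm_iteratedDeriv_standardFlow_le (lam : Fin n → ℝ) (x : E n) (t : ℝ) {l k : ℕ}
    (hl : l ≤ k) : ‖iteratedDeriv l (fun t => standardFlow lam t x) t‖
      ≤ (1 + ‖standardFormL lam‖) ^ k * ‖standardFlow lam t x‖ := by
  have h1 : (1 : ℝ) ≤ 1 + ‖standardFormL lam‖ := le_add_of_nonneg_right (norm_nonneg _)
  rw [iteratedDeriv_standardFlow]
  refine ((standardFormL lam ^ l).le_opNorm _).trans ?_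
  gcongr
  rcases Nat.eq_zero_or_pos l with rfl | hl0
  · rw [pow_zero]
    exact ContinuousLinearMap.norm_id_le.trans (one_le_pow₀ h1)
  · calc ‖standardFormL lam ^ l‖ ≤ ‖standardFormL lam‖ ^ l := norm_pow_le' _ hl0
      _ ≤ (1 + ‖standardFormL lam‖) ^ l := by gcongr; linarith
      _ ≤ _ := pow_le_pow_right₀ h1 hl

/-- A common lower bound of the positive exponents. -/
theorem exists_pos_le_of_pos (lam : Fin n → ℝ) : ∃ c : ℝ, 0 < c ∧ ∀ i, 0 < lam i → c ≤ lam i := by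
  have hall : ∀ᶠ c in nhdsWithin (0 : ℝ) (Ioi 0), ∀ i, 0 < lam i → c ≤ lam i := by
    rw [Filter.eventually_all]
    intro i
    by_cases h : 0 < lam i
    · filter_upwards [Ioo_mem_nhdsGT h] with c hc _ using hc.2.le
    · exact Filter.Eventually.of_forall fun c h' => absurd h' h
  obtain ⟨c, hc, hc'⟩ := (hall.and self_mem_nhdsWithin).exists
  exact ⟨c, hc', hc⟩

/-- Backward in time each unstable coordinate shrinks at rate at least `c`. -/
theorem norm_unstablePart_standardFlow_le {lam : Fin n → ℝ} {c : ℝ}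
    (hc : ∀ i, 0 < lam i → c ≤ lam i) (x : E n) {s : ℝ} (hs : s ≤ 0) :
    ‖unstablePart lam (standardFlow lam s x)‖ ≤ Real.exp (c * s) * ‖x‖ := by
  have he : Real.exp (c * s) * ‖x‖ = ‖Real.exp (c * s) • x‖ := by
    rw [norm_smul, Real.norm_eq_abs, abs_of_pos (Real.exp_pos _)]
  rw [he, EuclideanSpace.norm_eq, EuclideanSpace.norm_eq]
  refine Real.sqrt_le_sqrt (Finset.sum_le_sum fun i _ => ?_)
  gcongr
  simp only [unstablePart, standardFlow, PiLp.smul_apply, smul_eq_mul]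
  by_cases h : 0 < lam i
  · rw [if_pos h, norm_mul, norm_mul, mul_comm, Real.norm_eq_abs (Real.exp _),
      Real.norm_eq_abs (Real.exp _), abs_of_pos (Real.exp_pos _), abs_of_pos (Real.exp_pos _)]
    gcongr ?_ * _
    exact Real.exp_le_exp.2 (mul_le_mul_of_nonpos_right (hc i h) hs)
  · rw [if_neg h, norm_zero]
    positivity

theorem norm_stablePart_le (lam : Fin n → ℝ) (x : E n) : ‖stablePart lam x‖ ≤ ‖x‖ := by
  rw [EuclideanSpace.norm_eq, EuclideanSpace.norm_eq]
  refine Real.sqrt_le_sqrt (Finset.sum_le_sum fun i _ => ?_)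
  gcongr
  simp only [stablePart]
  split_ifs
  · exact le_rfl
  · rw [norm_zero]; positivity

/-- The nonlinear part `V - V₀`. -/
def nonlin (lam : Fin n → ℝ) (V : E n → E n) (x : E n) : E n := V x - standardForm lam x

variable {lam : Fin n → ℝ} {V : E n → E n}

theorem contDiff_nonlin (hV : ContDiff ℝ ∞ V) : ContDiff ℝ ∞ (nonlin lam V) :=
  hV.sub (standardFormL lam).contDiff

theorem integrand_eq (x : E n) (u : ℝ → E n) (s : ℝ) :
    integrand lam V x u s
      = standardFormL lam (u s) + nonlin lam V (u s + standardFlow lam s x) := by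
  have := map_add (standardFormL lam) (u s) (standardFlow lam s x)
  simp only [standardFormL_apply] at this
  simp only [integrand, nonlin, standardFormL_apply, this]
  abel

theorem exists_tsupport_nonlin_subset (h : HasCompactSupport (nonlin lam V)) :
    ∃ M : ℝ, 0 < M ∧ tsupport (nonlin lam V) ⊆ Metric.closedBall 0 M := by
  obtain ⟨M, hM⟩ := h.isCompact.isBounded.subset_closedBall (0 : E n)
  exact ⟨max M 1, by positivity, hM.trans (Metric.closedBall_subset_closedBall (le_max_left _ _))⟩

theorem iteratedDeriv_comp_eq_zero {f : E n → E n} {y : ℝ → E n} (hy : Continuous y) {t : ℝ}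
    (h : y t ∉ tsupport f) (j : ℕ) : iteratedDeriv j (f ∘ y) t = 0 := by
  have : f ∘ y =ᶠ[nhds t] fun _ => 0 := by
    filter_upwards [hy.continuousAt.eventually_mem
      ((isClosed_tsupport f).isOpen_compl.mem_nhds h)] with s hs
    exact image_eq_zero_of_notMem_tsupport (f := f) hs
  rw [this.iteratedDeriv_eq, iteratedDeriv_fun_const_zero]

/-- Lipschitz dependence of the derivatives of `(V - V₀)(u + F_t x)` on those of `u`, uniformly
in the (unbounded) orbit of `x`. -/
theorem exists_norm_iteratedDeriv_nonlin_sub_le (hV : ContDiff ℝ ∞ V)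
    (hs : HasCompactSupport (nonlin lam V)) (j : ℕ) (b : ℝ) :
    ∃ C : ℝ, 0 ≤ C ∧ ∀ (x : E n) (u₁ u₂ : ℝ → E n), ContDiff ℝ j u₁ → ContDiff ℝ j u₂ → ∀ t,
      (∀ l ≤ j, ‖iteratedDeriv l u₁ t‖ ≤ b) → (∀ l ≤ j, ‖iteratedDeriv l u₂ t‖ ≤ b) →
      ‖iteratedDeriv j (nonlin lam V ∘ fun s => u₁ s + standardFlow lam s x) t
          - iteratedDeriv j (nonlin lam V ∘ fun s => u₂ s + standardFlow lam s x) t‖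
        ≤ C * ∑ i ∈ Finset.range (j + 1), ‖iteratedDeriv i u₁ t - iteratedDeriv i u₂ t‖ := by
  obtain ⟨M, hM0, hM⟩ := exists_tsupport_nonlin_subset hs
  set Q := (1 + ‖standardFormL lam‖) ^ j
  obtain ⟨C, hC0, hC⟩ := exists_norm_iteratedDeriv_comp_sub_le j (contDiff_nonlin (lam := lam) hV)
    -- Bounds the jet of `u + F x` when the orbit has norm at most `M + b`: `b` for `u`, and `Q`
    -- times the norm of the orbit for the flow.
    (b + Q * (M + b))
  refine ⟨C, hC0, fun x u₁ u₂ hu₁ hu₂ t h₁ h₂ => ?_⟩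
  have hfl : ∀ l : ℕ, ContDiff ℝ l fun s => standardFlow lam s x := fun l =>
    (contDiff_standardFlow lam x).of_le (by exact_mod_cast le_top)
  have hadd : ∀ {u : ℝ → E n}, ContDiff ℝ j u → ∀ l ≤ j,
      iteratedDeriv l (fun s => u s + standardFlow lam s x) t
        = iteratedDeriv l u t + iteratedDeriv l (fun s => standardFlow lam s x) t := by
    intro u hu l hl
    exact iteratedDeriv_fun_add (hu.of_le (by exact_mod_cast hl)).contDiffAt (hfl l).contDiffAt
  by_cases hcase : ‖standardFlow lam t x‖ ≤ M + b
  · have hbd : ∀ {u : ℝ → E n}, ContDiff ℝ j u → (∀ l ≤ j, ‖iteratedDeriv l u t‖ ≤ b) →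
        ∀ l ≤ j, ‖iteratedDeriv l (fun s => u s + standardFlow lam s x) t‖ ≤ b + Q * (M + b) := by
      intro u hu hub l hl
      rw [hadd hu l hl]
      refine (norm_add_le _ _).trans (add_le_add (hub l hl) ?_)
      refine (norm_iteratedDeriv_standardFlow_le lam x t hl).trans ?_
      gcongr
    refine (hC _ _ (hu₁.add (hfl j)) (hu₂.add (hfl j)) t (hbd hu₁ h₁) (hbd hu₂ h₂)).trans_eq ?_
    congr 1
    refine Finset.sum_congr rfl fun i hi => ?_
    have hi' : i ≤ j := Nat.lt_succ_iff.1 (Finset.mem_range.1 hi)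
    rw [hadd hu₁ i hi', hadd hu₂ i hi', add_sub_add_right_eq_sub]
  -- An orbit point beyond `M + b`, displaced by at most `b`, lies outside the support, so both
  -- derivatives vanish.
  · have hz : ∀ {u : ℝ → E n}, ContDiff ℝ j u → (∀ l ≤ j, ‖iteratedDeriv l u t‖ ≤ b) →
        iteratedDeriv j (nonlin lam V ∘ fun s => u s + standardFlow lam s x) t = 0 := by
      intro u hu hub
      refine iteratedDeriv_comp_eq_zero (hu.continuous.add (hfl 0).continuous) (fun hmem => ?_) j
      have h1 : u t + standardFlow lam t x ∈ _ := hM hmem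
      rw [mem_closedBall_zero_iff] at h1
      have h2 := hub 0 (Nat.zero_le _)
      rw [iteratedDeriv_zero] at h2
      have h3 := norm_sub_le (u t + standardFlow lam t x) (u t)
      rw [add_sub_cancel_left] at h3
      linarith
    rw [hz hu₁ h₁, hz hu₂ h₂, sub_zero, norm_zero]
    positivity

/-- Flatness of `V - V₀`. -/
def IsFlat (lam : Fin n → ℝ) (V : E n → E n) : Prop :=
  ∃ α₀ : ℕ, ∀ α : ℕ, α₀ ≤ α → ∃ K : ℝ, ∀ x : E n,
    ‖nonlin lam V x‖ ≤ K * ‖unstablePart lam x‖ ^ α * ‖stablePart lam x‖ ^ α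

theorem IsFlat.nonlin_zero (h : IsFlat lam V) : nonlin lam V 0 = 0 := by
  obtain ⟨α₀, hα⟩ := h
  obtain ⟨K, hK⟩ := hα (α₀ + 1) (Nat.le_succ _)
  have h0 : unstablePart lam (0 : E n) = 0 := by ext i; simp [unstablePart]
  have := hK 0
  rw [h0, norm_zero, zero_pow (Nat.succ_ne_zero _), mul_zero, zero_mul] at this
  exact norm_le_zero_iff.1 this

/-- Off the support there is nothing to prove. On it the stable factor is at most `M ^ α`, while the
unstable factor `(R exp (c s)) ^ α` decays as fast as desired for `α` large. -/
theorem IsFlat.exists_norm_nonlin_flow_le (h : IsFlat lam V)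
    (hs : HasCompactSupport (nonlin lam V)) (m : ℕ) (d : ℝ) :
    ∃ A : ℝ, 0 ≤ A ∧ ∀ R : ℝ, 0 < R → R ≤ 1 → ∀ x : E n, ‖x‖ ≤ R → ∀ s ≤ (0 : ℝ),
      ‖nonlin lam V (standardFlow lam s x)‖ ≤ A * (R * Real.exp (d * s)) ^ m := by
  obtain ⟨M, hM0, hM⟩ := exists_tsupport_nonlin_subset hs
  obtain ⟨c, hc0, hc⟩ := exists_pos_le_of_pos lam
  obtain ⟨α₀, hα₀⟩ := h
  obtain ⟨N, hN⟩ := exists_nat_ge (m * d / c)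
  -- `α₀` makes the flatness bound available, `m` provides `R ^ m` (as `R ≤ 1`), and `N` provides
  -- the rate, since `N c ≥ m d`.
  set α := α₀ + m + N
  obtain ⟨K, hK⟩ := hα₀ α (by omega)
  refine ⟨|K| * M ^ α, by positivity, fun R hR0 hR1 x hx s hs0 => ?_⟩
  by_cases hmem : standardFlow lam s x ∈ tsupport (nonlin lam V)
  · have hyM : ‖standardFlow lam s x‖ ≤ M := mem_closedBall_zero_iff.1 (hM hmem)
    have hu : ‖unstablePart lam (standardFlow lam s x)‖ ≤ Real.exp (c * s) * R :=
      (norm_unstablePart_standardFlow_le hc x hs0).trans (by gcongr)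
    have hexp : (Real.exp (c * s) * R) ^ α ≤ (R * Real.exp (d * s)) ^ m := by
      rw [mul_pow, mul_pow, mul_comm, ← Real.exp_nat_mul, ← Real.exp_nat_mul]
      refine mul_le_mul (pow_le_pow_of_le_one hR0.le hR1 (by omega)) (Real.exp_le_exp.2 ?_)
        (Real.exp_pos _).le (by positivity)
      rw [← mul_assoc, ← mul_assoc]
      refine mul_le_mul_of_nonpos_right ?_ hs0
      have h1 : (m : ℝ) * d ≤ N * c := (div_le_iff₀ hc0).1 hN
      have h2 : (N : ℝ) ≤ α := by exact_mod_cast Nat.le_add_left N (α₀ + m)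
      nlinarith
    calc ‖nonlin lam V (standardFlow lam s x)‖
        ≤ K * ‖unstablePart lam (standardFlow lam s x)‖ ^ α
            * ‖stablePart lam (standardFlow lam s x)‖ ^ α := hK _
      _ ≤ |K| * (Real.exp (c * s) * R) ^ α * M ^ α := by
          gcongr
          · exact le_abs_self K
          · exact (norm_stablePart_le lam _).trans hyM
      _ = |K| * M ^ α * (Real.exp (c * s) * R) ^ α := by ring
      _ ≤ _ := by gcongr
  · rw [image_eq_zero_of_notMem_tsupport hmem, norm_zero]
    positivity

/-- Decay of the derivatives of `(V - V₀)(F_s x)`, for `x` near the origin. -/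
theorem IsFlat.exists_norm_iteratedDeriv_nonlin_flow_le (h : IsFlat lam V) (hV : ContDiff ℝ ∞ V)
    (hs : HasCompactSupport (nonlin lam V)) (k : ℕ) {d : ℝ} (hd : 0 ≤ d) :
    ∃ A : ℝ, 0 ≤ A ∧ ∀ R : ℝ, 0 < R → R ≤ 1 → ∀ x : E n, ‖x‖ ≤ R → ∀ j ≤ k, ∀ s ≤ (0 : ℝ),
      ‖iteratedDeriv j (nonlin lam V ∘ fun s => standardFlow lam s x) s‖
        ≤ A * R * Real.exp (d * s) := by
  obtain ⟨M, hM0, hM⟩ := exists_tsupport_nonlin_subset hs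
  set Q := (1 + ‖standardFormL lam‖) ^ (k + 1)
  have hQ0 : 0 ≤ Q * M := by positivity
  obtain ⟨A, hA0, hA⟩ := h.exists_norm_nonlin_flow_le hs (2 ^ k) d
  choose C hC0 hC using fun j =>
    exists_norm_iteratedDeriv_comp_sub_le j (contDiff_nonlin (lam := lam) hV) (Q * M)
  -- A common bound for the derivatives of order up to `k + 1` along all orbits: each summand
  -- compares the orbit, where it meets the support, with the constant curve 0, on which the
  -- nonlinear part vanishes.
  set B := ∑ j ∈ Finset.range (k + 2), C j * ((j + 1) * (Q * M))
  have hterm : ∀ j, 0 ≤ C j * ((j + 1) * (Q * M)) := fun j => by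
    have := hC0 j
    positivity
  have hB0 : 0 ≤ B := Finset.sum_nonneg fun j _ => hterm j
  refine ⟨3 ^ k * (A + B), by positivity, fun R hR0 hR1 x hx j hj s hs0 => ?_⟩
  have hfl := contDiff_standardFlow lam x
  have hbd : ∀ j ≤ k + 1, ∀ t ≤ (0 : ℝ),
      ‖iteratedDeriv j (nonlin lam V ∘ fun s => standardFlow lam s x) t‖ ≤ B := by
    intro j hj t _
    by_cases hmem : standardFlow lam t x ∈ tsupport (nonlin lam V)
    · have hyM : ‖standardFlow lam t x‖ ≤ M := mem_closedBall_zero_iff.1 (hM hmem)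
      have hder : ∀ l ≤ j, ‖iteratedDeriv l (fun s => standardFlow lam s x) t‖ ≤ Q * M :=
        fun l hl => (norm_iteratedDeriv_standardFlow_le lam x t (hl.trans hj)).trans (by gcongr)
      have h1 := hC j (fun s => standardFlow lam s x) (fun _ => 0)
        (hfl.of_le (by exact_mod_cast le_top)) contDiff_const t hder
        (fun l _ => by rw [iteratedDeriv_fun_const_zero, norm_zero]; exact hQ0)
      have h2 : (nonlin lam V ∘ fun _ : ℝ => (0 : E n)) = fun _ => 0 :=
        funext fun _ => h.nonlin_zero
      simp only [h2, iteratedDeriv_fun_const_zero, sub_zero] at h1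
      refine h1.trans (le_trans ?_ (Finset.single_le_sum (fun i _ => hterm i)
        (Finset.mem_range.2 (Nat.lt_succ_of_le hj))))
      refine mul_le_mul_of_nonneg_left ?_ (hC0 j)
      refine (Finset.sum_le_card_nsmul _ _ (Q * M) fun i hi =>
        hder i (Nat.lt_succ_iff.1 (Finset.mem_range.1 hi))).trans_eq ?_
      rw [Finset.card_range, nsmul_eq_mul]
      push_cast
      rfl
    · rw [iteratedDeriv_comp_eq_zero hfl.continuous hmem, norm_zero]
      exact hB0
  have := norm_iteratedDeriv_le_of_norm_le_pow
    ((contDiff_nonlin (lam := lam) hV).comp hfl) (A := A) (B := B)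
    (ρ := fun s => R * Real.exp (d * s)) (fun a b hab => by
      dsimp only; gcongr) (fun t => by positivity) (fun t ht => by
      have : Real.exp (d * t) ≤ 1 := Real.exp_le_one_iff.2 (mul_nonpos_of_nonneg_of_nonpos hd ht)
      have := Real.exp_pos (d * t)
      nlinarith) (fun t ht => hA R hR0 hR1 x hx t ht) hbd hj hs0
  refine this.trans ?_
  rw [← mul_assoc]
  gcongr
  norm_num

end

/-! ### The integrand and the weak derivatives of the operator. -/

section

section LpNorm
variable {F : Type*} [NormedAddCommGroup F] [NormedSpace ℝ F] {p δ : ℝ}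

theorem lpNorm_le_mul_sum {ι : Type*} {S : Finset ι} (hp : 1 ≤ p) {c : ℝ} {f : ℝ → F}
    {g : ι → ℝ → F} (hg : ∀ i ∈ S, AEStronglyMeasurable (g i) (volume.restrict (Iic 0)))
    (h : ∀ᵐ t ∂volume.restrict (Iic 0), ‖f t‖ ≤ c * ∑ i ∈ S, ‖g i t‖) :
    lpNorm p δ f ≤ ENNReal.ofReal c * ∑ i ∈ S, lpNorm p δ (g i) := by
  have h1 : eLpNorm (∑ i ∈ S, fun t => ‖weighted δ (g i) t‖) (ENNReal.ofReal p)
      (volume.restrict (Iic 0)) ≤ ∑ i ∈ S, lpNorm p δ (g i) := by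
    refine (eLpNorm_sum_le (fun i hi => (aestronglyMeasurable_weighted (hg i hi)).norm)
      (by simpa using hp)).trans (Finset.sum_le_sum fun i _ => ?_)
    rw [eLpNorm_norm, lpNorm]
  refine le_trans ?_ (mul_le_mul_right h1 _)
  refine eLpNorm_le_mul_eLpNorm_of_ae_le_mul ?_ _
  filter_upwards [h] with t ht
  have e : (∑ i ∈ S, fun t => ‖weighted δ (g i) t‖) t
      = Real.exp (-δ * t) * ∑ i ∈ S, ‖g i t‖ := by
    rw [Finset.sum_apply, Finset.mul_sum]
    refine Finset.sum_congr rfl fun i _ => ?_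
    rw [weighted, norm_smul, Real.norm_eq_abs, abs_of_pos (Real.exp_pos _)]
  have h0 : 0 ≤ ∑ i ∈ S, ‖g i t‖ := Finset.sum_nonneg fun _ _ => norm_nonneg _
  rw [e, weighted, norm_smul, Real.norm_eq_abs, abs_of_pos (Real.exp_pos _), Real.norm_eq_abs,
    abs_of_nonneg (by positivity), mul_left_comm]
  gcongr

theorem lpNorm_le_mul (hp : 1 ≤ p) {c : ℝ} {f g : ℝ → F}
    (hg : AEStronglyMeasurable g (volume.restrict (Iic 0)))
    (h : ∀ᵐ t ∂volume.restrict (Iic 0), ‖f t‖ ≤ c * ‖g t‖) :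
    lpNorm p δ f ≤ ENNReal.ofReal c * lpNorm p δ g := by
  simpa using lpNorm_le_mul_sum (S := Finset.univ (α := Unit)) (g := fun _ => g) hp (fun _ _ => hg)
    (by simpa using h)

/-- The rate `δ + 1` leaves `exp t` after weighting, and `∫ exp (p t) = 1 / p ≤ 1` over the half
line. -/
theorem lpNorm_le_of_norm_le_exp (hp : 1 < p) {c : ℝ} (hc : 0 ≤ c) {f : ℝ → F}
    (h : ∀ t ≤ 0, ‖f t‖ ≤ c * Real.exp ((δ + 1) * t)) : lpNorm p δ f ≤ ENNReal.ofReal c := by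
  have hp0 : 0 < p := by linarith
  rw [lpNorm, eLpNorm_eq_lintegral_rpow_enorm_toReal (by simpa using hp0) ENNReal.ofReal_ne_top,
    ENNReal.toReal_ofReal hp0.le]
  have h1 : ∫⁻ t in Iic 0, ‖weighted δ f t‖ₑ ^ p
      ≤ ∫⁻ t in Iic 0, ENNReal.ofReal c ^ p * ENNReal.ofReal (Real.exp (p * t)) := by
    refine setLIntegral_mono' measurableSet_Iic fun t ht => ?_
    have h2 : ‖weighted δ f t‖ₑ ≤ ENNReal.ofReal (c * Real.exp t) := by
      rw [← ofReal_norm]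
      refine ENNReal.ofReal_le_ofReal ?_
      rw [weighted, norm_smul, Real.norm_eq_abs, abs_of_pos (Real.exp_pos _)]
      refine (mul_le_mul_of_nonneg_left (h t ht) (Real.exp_pos _).le).trans_eq ?_
      rw [mul_left_comm, ← Real.exp_add]
      ring_nf
    refine (ENNReal.rpow_le_rpow h2 hp0.le).trans_eq ?_
    rw [ENNReal.ofReal_mul hc, ENNReal.mul_rpow_of_nonneg _ _ hp0.le,
      ENNReal.ofReal_rpow_of_pos (Real.exp_pos _), ← Real.exp_mul, mul_comm t p]
  calc (∫⁻ t in Iic 0, ‖weighted δ f t‖ₑ ^ p) ^ (1 / p)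
      ≤ (ENNReal.ofReal c ^ p) ^ (1 / p) := by
        gcongr
        refine h1.trans ?_
        rw [lintegral_const_mul' _ _ (ENNReal.rpow_ne_top_of_nonneg hp0.le ENNReal.ofReal_ne_top),
          lintegral_exp_mul_Iic hp0]
        refine mul_le_of_le_one_right' ?_
        rw [mul_zero, Real.exp_zero, ENNReal.ofReal_le_one, div_le_one hp0]
        exact hp.le
    _ = ENNReal.ofReal c := by
        rw [← ENNReal.rpow_mul, mul_one_div_cancel hp0.ne', ENNReal.rpow_one]

theorem lpNorm_prim_le (hp : 1 < p) (hδ : 0 < δ) {w : ℝ → F}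
    (hw : AEStronglyMeasurable w (volume.restrict (Iic 0))) :
    lpNorm p δ (prim w) ≤ ENNReal.ofReal (1 / δ) * lpNorm p δ w :=
  eLpNorm_weighted_prim_restrict_le hp hδ hw

theorem lpNorm_le_sub_add (hp : 1 ≤ p) {f g : ℝ → F}
    (hf : AEStronglyMeasurable f (volume.restrict (Iic 0)))
    (hg : AEStronglyMeasurable g (volume.restrict (Iic 0))) :
    lpNorm p δ f ≤ lpNorm p δ (f - g) + lpNorm p δ g := by
  have e : weighted δ f = weighted δ (f - g) + weighted δ g := by
    funext t
    simp [weighted, smul_sub]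
  rw [lpNorm, e]
  exact eLpNorm_add_le (aestronglyMeasurable_weighted (hf.sub hg))
    (aestronglyMeasurable_weighted hg) (by simpa using hp)

end LpNorm

variable {n : ℕ} {p δ : ℝ} {k : ℕ} {u u₁ u₂ : ℝ → E n} {lam : Fin n → ℝ} {V : E n → E n}

theorem IsWeakDeriv.aestronglyMeasurable {j : ℕ} {v : ℝ → E n} (h : IsWeakDeriv j u v) :
    AEStronglyMeasurable v (volume.restrict (Iic 0)) := by
  rw [← restrict_Iio_eq_restrict_Iic]
  exact h.2.1.aestronglyMeasurable

theorem wNorm_le_sub_add (hp : 1 ≤ p) {v₁ v₂ : ℕ → ℝ → E n}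
    (h₁ : ∀ j ≤ k, IsWeakDeriv j u₁ (v₁ j)) (h₂ : ∀ j ≤ k, IsWeakDeriv j u₂ (v₂ j)) :
    wNorm p k δ u₁ ≤ wNorm p k δ (u₁ - u₂) + wNorm p k δ u₂ := by
  rw [wNorm_eq_sum h₁, wNorm_eq_sum h₂,
    wNorm_eq_sum (v := fun j => v₁ j - v₂ j) fun j hj => (h₁ j hj).sub (h₂ j hj),
    ← Finset.sum_add_distrib]
  refine Finset.sum_le_sum fun j hj => ?_
  have hj' := Nat.lt_succ_iff.1 (Finset.mem_range.1 hj)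
  exact lpNorm_le_sub_add hp (h₁ j hj').aestronglyMeasurable (h₂ j hj').aestronglyMeasurable

theorem prim_iterate_zero (k : ℕ) : prim^[k] (0 : ℝ → E n) = 0 :=
  Function.iterate_fixed (by funext t; simp [prim]) k

theorem isWeakDeriv_zero_prim_iterate (j i : ℕ) :
    IsWeakDeriv j (0 : ℝ → E n) (prim^[i] (0 : ℝ → E n)) := by
  rw [prim_iterate_zero]
  have h := ContDiff.isWeakDeriv_iteratedDeriv (j := j)
    (contDiff_const : ContDiff ℝ j fun _ : ℝ => (0 : E n))
  have e : iteratedDeriv j (fun _ : ℝ => (0 : E n)) = 0 :=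
    funext fun t => iteratedDeriv_fun_const_zero
  rwa [e] at h

theorem wNorm_zero : wNorm p k δ (0 : ℝ → E n) = 0 := by
  rw [wNorm_eq_sum (v := fun _ => 0) fun j _ => by simpa using isWeakDeriv_zero_prim_iterate j 0]
  refine Finset.sum_eq_zero fun j _ => ?_
  have : weighted δ (0 : ℝ → E n) = 0 := by funext t; simp [weighted]
  rw [lpNorm, this, eLpNorm_zero]

theorem integrand_congr {x : E n} (h : u₁ =ᵐ[volume.restrict (Iic 0)] u₂) :
    integrand lam V x u₁ =ᵐ[volume.restrict (Iic 0)] integrand lam V x u₂ := by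
  filter_upwards [h] with t ht
  simp [integrand, ht]

theorem contDiff_integrand (hV : ContDiff ℝ ∞ V) {m : ℕ} (hu : ContDiff ℝ m u) (x : E n) :
    ContDiff ℝ m (integrand lam V x u) := by
  have e : integrand lam V x u = fun s =>
      standardFormL lam (u s) + nonlin lam V (u s + standardFlow lam s x) :=
    funext (integrand_eq x u)
  rw [e]
  exact ((standardFormL lam).contDiff.comp hu).add
    (((contDiff_nonlin hV).of_le (by exact_mod_cast le_top)).comp
      (hu.add ((contDiff_standardFlow lam x).of_le (by exact_mod_cast le_top))))

/-- The weak derivatives of `opF lam V x u`. -/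
def opFDeriv (lam : Fin n → ℝ) (V : E n → E n) (x : E n) (G : ℝ → E n) : ℕ → ℝ → E n
  | 0 => opF lam V x G
  | i + 1 => iteratedDeriv i (integrand lam V x G)

/-- For `k ≥ 1` the representative `prim^[k] w` is `C^{k-1}`, hence so is the integrand, and its
primitive is `C^k`: the weak derivatives are classical ones. For `k = 0` only continuity of the
primitive on the half line is used. -/
theorem isWeakDeriv_opFDeriv (hV : ContDiff ℝ ∞ V) (x : E n) {w : ℝ → E n} (hp : 1 < p)
    (hδ : 0 < δ) (hw : MemLp (weighted δ w) (ENNReal.ofReal p))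
    (hu : u =ᵐ[volume.restrict (Iic 0)] prim^[k] w)
    (hi : IntegrableOn (integrand lam V x (prim^[k] w)) (Iic 0)) :
    ∀ j ≤ k, IsWeakDeriv j (opF lam V x u) (opFDeriv lam V x (prim^[k] w) j) := by
  have hop : opF lam V x (prim^[k] w) =ᵐ[volume.restrict (Iic 0)] opF lam V x u := by
    filter_upwards [ae_restrict_mem measurableSet_Iic] with t ht
    exact prim_congr_Iic (integrand_congr hu.symm) ht
  intro j hj
  cases j with
  | zero =>
    refine (isWeakDeriv_zero ?_).congr hop (Filter.EventuallyEq.refl _ _)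
    have hc := continuous_prim (w := (Iic (0 : ℝ)).indicator (integrand lam V x (prim^[k] w)))
      fun t => ((integrable_indicator_iff measurableSet_Iic).2 hi).integrableOn
    refine (hc.continuousOn.congr fun t ht => ?_).locallyIntegrableOn measurableSet_Iio
    refine setIntegral_congr_fun measurableSet_Iic fun s hs => ?_
    rw [indicator_of_mem (mem_Iic.2 ((mem_Iic.1 hs).trans (le_of_lt ht)))]
  | succ i =>
    obtain ⟨m, rfl⟩ : ∃ m, k = m + 1 := ⟨k - 1, by omega⟩
    have hJ := contDiff_integrand (lam := lam) hV (contDiff_prim_iterate hp hδ hw m) x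
    have hJi : ∀ t, IntegrableOn (integrand lam V x (prim^[m + 1] w)) (Iic t) := fun t =>
      -- Beyond 0 nothing is assumed, but the integrand is continuous, so the compact piece `[0, t]`
      -- is harmless.
      (hi.union (hJ.continuous.integrableOn_Icc (a := 0) (b := t))).mono_set fun s hs =>
        (le_total s 0).imp id fun h => ⟨h, hs⟩
    have hP := contDiff_prim hJi (hJ.of_le (by exact_mod_cast Nat.lt_succ_iff.1 hj : (i : ℕ∞ω) ≤ m))
    have h := ContDiff.isWeakDeriv_iteratedDeriv hP
    rw [iteratedDeriv_succ', deriv_prim hJi hJ.continuous] at h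
    exact h.congr hop (Filter.EventuallyEq.refl _ _)

theorem exists_norm_integrand_sub_le (hV : ContDiff ℝ ∞ V) (hs : HasCompactSupport (nonlin lam V)) :
    ∃ L : ℝ, 0 ≤ L ∧ ∀ (x : E n) (u₁ u₂ : ℝ → E n) (t : ℝ),
      ‖integrand lam V x u₁ t - integrand lam V x u₂ t‖ ≤ L * ‖u₁ t - u₂ t‖ := by
  obtain ⟨K, hK⟩ := ((contDiff_nonlin (lam := lam) hV).of_le
    (by exact_mod_cast le_top : (1 : ℕ∞ω) ≤ ((⊤ : ℕ∞) : ℕ∞ω))).lipschitzWith_of_hasCompactSupport hs one_ne_zero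
  refine ⟨‖standardFormL lam‖ + K, by positivity, fun x u₁ u₂ t => ?_⟩
  rw [integrand_eq, integrand_eq, add_sub_add_comm, ← map_sub, add_mul]
  refine (norm_add_le _ _).trans (add_le_add ((standardFormL lam).le_opNorm _) ?_)
  have := hK.norm_sub_le (u₁ t + standardFlow lam t x) (u₂ t + standardFlow lam t x)
  rwa [add_sub_add_right_eq_sub] at this

theorem integrand_zero (x : E n) :
    integrand lam V x 0 = nonlin lam V ∘ fun s => standardFlow lam s x := by
  funext s
  simp [integrand_eq, -standardFormL_apply]

/-- Comparison with the zero curve: the difference is at most `L ‖u‖`, integrable by Hölder, and the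
remainder decays exponentially. -/
theorem integrableOn_integrand (hV : ContDiff ℝ ∞ V) (hs : HasCompactSupport (nonlin lam V))
    (hp : 1 < p) (hδ : 0 < δ) {x : E n} {c : ℝ}
    (hx : ∀ s ≤ 0, ‖integrand lam V x 0 s‖ ≤ c * Real.exp ((δ + 1) * s))
    (hu : MemLp (weighted δ u) (ENNReal.ofReal p) (volume.restrict (Iic 0))) :
    IntegrableOn (integrand lam V x u) (Iic 0) := by
  obtain ⟨L, hL0, hL⟩ := exists_norm_integrand_sub_le hV hs
  have hi := integrableOn_Iic_of_weighted hp hδ 0 hu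
  have hm : AEStronglyMeasurable (integrand lam V x u) (volume.restrict (Iic 0)) :=
    (hV.continuous.comp_aestronglyMeasurable
      (hi.1.add (contDiff_standardFlow lam x).continuous.aestronglyMeasurable)).sub
      ((standardFormL lam).continuous.comp
        (contDiff_standardFlow lam x).continuous).aestronglyMeasurable
  have hexp : IntegrableOn (fun s => Real.exp ((δ + 1) * s)) (Iic 0) :=
    integrableOn_exp_mul_Iic (by linarith) 0
  refine ((hi.norm.const_mul L).add (hexp.const_mul c)).mono' hm ?_
  filter_upwards [ae_restrict_mem measurableSet_Iic] with s hs'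
  have h1 := hL x u 0 s
  have h2 := norm_le_norm_sub_add (integrand lam V x u s) (integrand lam V x 0 s)
  simp only [Pi.zero_apply, sub_zero] at h1
  exact h2.trans (add_le_add h1 (hx s hs'))

/-- Derivatives of the integrand depend on those of the curve in a Lipschitz way. -/
theorem exists_norm_iteratedDeriv_integrand_sub_le (hV : ContDiff ℝ ∞ V)
    (hs : HasCompactSupport (nonlin lam V)) (j : ℕ) (b : ℝ) :
    ∃ C : ℝ, 0 ≤ C ∧ ∀ (x : E n) (u₁ u₂ : ℝ → E n), ContDiff ℝ j u₁ → ContDiff ℝ j u₂ → ∀ t,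
      (∀ l ≤ j, ‖iteratedDeriv l u₁ t‖ ≤ b) → (∀ l ≤ j, ‖iteratedDeriv l u₂ t‖ ≤ b) →
      ‖iteratedDeriv j (integrand lam V x u₁) t - iteratedDeriv j (integrand lam V x u₂) t‖
        ≤ C * ∑ i ∈ Finset.range (j + 1), ‖iteratedDeriv i u₁ t - iteratedDeriv i u₂ t‖ := by
  obtain ⟨C, hC0, hC⟩ := exists_norm_iteratedDeriv_nonlin_sub_le hV hs j b
  refine ⟨‖standardFormL lam‖ + C, by positivity, fun x u₁ u₂ hu₁ hu₂ t h₁ h₂ => ?_⟩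
  have hdec : ∀ {u : ℝ → E n}, ContDiff ℝ j u → iteratedDeriv j (integrand lam V x u) t
      = standardFormL lam (iteratedDeriv j u t)
        + iteratedDeriv j (nonlin lam V ∘ fun s => u s + standardFlow lam s x) t := by
    intro u hu
    have e : integrand lam V x u = fun s => (standardFormL lam ∘ u) s +
        (nonlin lam V ∘ fun s => u s + standardFlow lam s x) s := funext (integrand_eq x u)
    have hlin : iteratedDeriv j (standardFormL lam ∘ u) t
        = standardFormL lam (iteratedDeriv j u t) := by
      simp only [iteratedDeriv_eq_iteratedFDeriv]
      rw [(standardFormL lam).iteratedFDeriv_comp_left hu.contDiffAt le_rfl]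
      rfl
    rw [e, iteratedDeriv_fun_add ((standardFormL lam).contDiff.comp hu).contDiffAt
      (((contDiff_nonlin hV).of_le (by exact_mod_cast le_top)).comp
      (hu.add ((contDiff_standardFlow lam x).of_le (by exact_mod_cast le_top)))).contDiffAt, hlin]
  rw [hdec hu₁, hdec hu₂, add_sub_add_comm, ← map_sub, add_mul]
  refine (norm_add_le _ _).trans (add_le_add (((standardFormL lam).le_opNorm _).trans ?_)
    (hC x u₁ u₂ hu₁ hu₂ t h₁ h₂))
  gcongr
  exact Finset.single_le_sum (f := fun i => ‖iteratedDeriv i u₁ t - iteratedDeriv i u₂ t‖)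
    (fun _ _ => norm_nonneg _) (Finset.self_mem_range_succ j)

end

/-! ### Contraction estimate and size at the zero curve. -/

section
variable {n : ℕ} {p δ : ℝ} {k : ℕ} {u u₁ u₂ : ℝ → E n} {lam : Fin n → ℝ} {V : E n → E n}

theorem memLp_weighted_of_wNorm_lt_top (h : wNorm p k δ u < ⊤) :
    MemLp (weighted δ u) (ENNReal.ofReal p) (volume.restrict (Iic 0)) := by
  obtain ⟨v, hv⟩ := exists_isWeakDeriv_of_wNorm_lt_top h
  have h0 := (isWeakDeriv_zero (hv 0 (Nat.zero_le _)).1)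
  refine ⟨aestronglyMeasurable_weighted h0.aestronglyMeasurable, ?_⟩
  rw [wNorm_eq_sum hv] at h
  have h1 := (ENNReal.sum_lt_top.1 h) 0 (Finset.mem_range.2 (Nat.succ_pos k))
  rwa [← lpNorm_congr (h0.ae_unique (hv 0 (Nat.zero_le _)))] at h1

/-- The Lipschitz constant of `opF` on a ball is of size `1 / δ`. -/
theorem exists_wNorm_opF_sub_le (hV : ContDiff ℝ ∞ V) (hs : HasCompactSupport (nonlin lam V))
    (hp : 1 < p) (k : ℕ) {r : ℝ} (hr : 0 ≤ r) :
    ∃ D : ℝ, 0 ≤ D ∧ ∀ δ : ℝ, 1 ≤ δ → ∀ x : E n,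
      (∀ u : ℝ → E n, MemLp (weighted δ u) (ENNReal.ofReal p) (volume.restrict (Iic 0)) →
        IntegrableOn (integrand lam V x u) (Iic 0)) →
      ∀ u₁ ∈ Omega n p k δ r, ∀ u₂ ∈ Omega n p k δ r,
        wNorm p k δ (opF lam V x u₁ - opF lam V x u₂)
          ≤ ENNReal.ofReal (D / δ) * wNorm p k δ (u₁ - u₂) := by
  obtain ⟨L, hL0, hL⟩ := exists_norm_integrand_sub_le hV hs
  choose C hC0 hC using fun j => exists_norm_iteratedDeriv_integrand_sub_le hV hs j r
  have hterm : ∀ i : ℕ, 0 ≤ C i * (i + 1) := fun i => by have := hC0 i; positivity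
  -- `L` accounts for order 0, and `C i * (i + 1)` for order `i + 1`, with one contribution for each
  -- of the `i + 1` derivatives of the curve that occur.
  refine ⟨∑ i ∈ Finset.range k, C i * (i + 1) + L,
    add_nonneg (Finset.sum_nonneg fun i _ => hterm i) hL0, ?_⟩
  intro δ hδ x hint u₁ hu₁ u₂ hu₂
  have hδ0 : 0 < δ := by linarith
  obtain ⟨w₁, hw₁, hae₁, hd₁⟩ := exists_prim_iterate_of_wNorm_lt_top hp hδ0 hu₁.1
  obtain ⟨w₂, hw₂, hae₂, hd₂⟩ := exists_prim_iterate_of_wNorm_lt_top hp hδ0 hu₂.1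
  have hm₁ := memLp_weighted_prim_iterate hp hδ0 hw₁
  have hm₂ := memLp_weighted_prim_iterate hp hδ0 hw₂
  have hi₁ := hint _ ((hm₁ k).mono_measure Measure.restrict_le_self)
  have hi₂ := hint _ ((hm₂ k).mono_measure Measure.restrict_le_self)
  set N := wNorm p k δ (u₁ - u₂)
  have hmeas : ∀ i, AEStronglyMeasurable (prim^[i] w₁ - prim^[i] w₂) (volume.restrict (Iic 0)) :=
    fun i => ((aestronglyMeasurable_of_weighted (hm₁ i).1).sub
      (aestronglyMeasurable_of_weighted (hm₂ i).1)).restrict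
  have hN : ∀ i ≤ k, lpNorm p δ (prim^[i] w₁ - prim^[i] w₂) ≤ N := fun i hi =>
    lpNorm_prim_iterate_sub_le_wNorm hd₁ hd₂ hi
  have h0 : lpNorm p δ (opFDeriv lam V x (prim^[k] w₁) 0 - opFDeriv lam V x (prim^[k] w₂) 0)
      ≤ ENNReal.ofReal (1 / δ) * (ENNReal.ofReal L * N) := by
    have e : (opFDeriv lam V x (prim^[k] w₁) 0 - opFDeriv lam V x (prim^[k] w₂) 0)
        =ᵐ[volume.restrict (Iic 0)]
          prim (integrand lam V x (prim^[k] w₁) - integrand lam V x (prim^[k] w₂)) := by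
      filter_upwards [ae_restrict_mem measurableSet_Iic] with t ht
      exact (integral_sub (hi₁.mono_set (Iic_subset_Iic.2 ht))
        (hi₂.mono_set (Iic_subset_Iic.2 ht))).symm
    rw [lpNorm_congr e]
    refine (lpNorm_prim_le hp hδ0 (hi₁.sub hi₂).1).trans ?_
    gcongr
    refine (lpNorm_le_mul (c := L) hp.le (hmeas k)
      (Filter.Eventually.of_forall fun t => hL x _ _ t)).trans ?_
    gcongr
    exact hN k le_rfl
  -- Order `i + 1` of the operator sees only derivatives of the curves of order `l ≤ i < k`. Each
  -- difference `prim^[k - l] w₁ - prim^[k - l] w₂` is still a primitive, so Hardy gains `1 / δ`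
  -- here too.
  have hsucc : ∀ i ∈ Finset.range k,
      lpNorm p δ (opFDeriv lam V x (prim^[k] w₁) (i + 1) - opFDeriv lam V x (prim^[k] w₂) (i + 1))
        ≤ ENNReal.ofReal (C i * (i + 1)) * (ENNReal.ofReal (1 / δ) * N) := by
    intro i hi
    rw [Finset.mem_range] at hi
    have hder : ∀ {w : ℝ → E n}, MemLp (weighted δ w) (ENNReal.ofReal p) → ∀ l ≤ i,
        iteratedDeriv l (prim^[k] w) = prim^[k - l] w := by
      intro w hw l hl
      have := iteratedDeriv_prim_iterate hp hδ0 hw (k - l - 1) l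
      rwa [show k - l - 1 + 1 = k - l by omega, Nat.sub_add_cancel (by omega)] at this
    have hcd : ∀ {w : ℝ → E n}, MemLp (weighted δ w) (ENNReal.ofReal p) →
        ContDiff ℝ i (prim^[k] w) := by
      intro w hw
      have := contDiff_prim_iterate hp hδ0 hw (k - 1)
      rw [Nat.sub_add_cancel (by omega)] at this
      exact this.of_le (by exact_mod_cast Nat.le_sub_one_of_lt hi)
    have hbd : ∀ {u w : ℝ → E n}, u ∈ Omega n p k δ r → MemLp (weighted δ w) (ENNReal.ofReal p) →
        (∀ j ≤ k, IsWeakDeriv j u (prim^[k - j] w)) → ∀ t ≤ 0, ∀ l ≤ i,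
        ‖iteratedDeriv l (prim^[k] w) t‖ ≤ r := by
      intro u w hu hw hd t ht l hl
      rw [hder hw l hl, show k - l = (k - l - 1) + 1 by omega]
      exact norm_prim_iterate_le hp hδ hr hw hd hu.2 (by omega) ht
    have h1 := lpNorm_le_mul_sum (p := p) (δ := δ) (S := Finset.range (i + 1)) (c := C i) hp.le
      (f := opFDeriv lam V x (prim^[k] w₁) (i + 1) - opFDeriv lam V x (prim^[k] w₂) (i + 1))
      (g := fun l => prim^[k - l] w₁ - prim^[k - l] w₂) (fun l _ => hmeas (k - l)) (by
        filter_upwards [ae_restrict_mem measurableSet_Iic] with t ht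
        refine (hC i x _ _ (hcd hw₁) (hcd hw₂) t (hbd hu₁ hw₁ hd₁ t ht)
          (hbd hu₂ hw₂ hd₂ t ht)).trans_eq ?_
        congr 1
        refine Finset.sum_congr rfl fun l hl => ?_
        have hl' : l ≤ i := Nat.lt_succ_iff.1 (Finset.mem_range.1 hl)
        rw [hder hw₁ l hl', hder hw₂ l hl', Pi.sub_apply])
    refine h1.trans ?_
    rw [ENNReal.ofReal_mul (hC0 i), mul_assoc]
    gcongr
    refine (Finset.sum_le_card_nsmul _ _ (ENNReal.ofReal (1 / δ) * N) fun l hl => ?_).trans_eq ?_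
    · have hl' : l ≤ i := Nat.lt_succ_iff.1 (Finset.mem_range.1 hl)
      rw [show k - l = (k - l - 1) + 1 by omega]
      refine (lpNorm_prim_iterate_sub_le hp hδ0 hw₁ hw₂ _).trans ?_
      gcongr
      exact hN _ (by omega)
    · rw [Finset.card_range, nsmul_eq_mul, ← Nat.cast_succ, ENNReal.ofReal_natCast]
  rw [wNorm_eq_sum fun j hj => (isWeakDeriv_opFDeriv hV x hp hδ0 hw₁ hae₁ hi₁ j hj).sub
    (isWeakDeriv_opFDeriv hV x hp hδ0 hw₂ hae₂ hi₂ j hj), Finset.sum_range_succ']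
  refine (add_le_add (Finset.sum_le_sum hsucc) h0).trans_eq ?_
  rw [← Finset.sum_mul, ← ENNReal.ofReal_sum_of_nonneg fun i _ => hterm i,
    div_eq_mul_one_div (_ + L),
    ENNReal.ofReal_mul (add_nonneg (Finset.sum_nonneg fun i _ => hterm i) hL0),
    ENNReal.ofReal_add (Finset.sum_nonneg fun i _ => hterm i) hL0]
  ring

/-- The norm of `opF lam V x 0` tends to zero with `x`. -/
theorem wNorm_opF_zero_le (hV : ContDiff ℝ ∞ V) (hp : 1 < p) (hδ : 1 ≤ δ) {x : E n} {c : ℝ}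
    (hc : 0 ≤ c) (hx : ∀ j ≤ k, ∀ s ≤ 0,
      ‖iteratedDeriv j (integrand lam V x 0) s‖ ≤ c * Real.exp ((δ + 1) * s))
    (hi : IntegrableOn (integrand lam V x 0) (Iic 0)) :
    wNorm p k δ (opF lam V x 0) ≤ ENNReal.ofReal ((k + 1) * c) := by
  have hδ0 : 0 < δ := by linarith
  have hw : MemLp (weighted δ (0 : ℝ → E n)) (ENNReal.ofReal p) := by
    have : weighted δ (0 : ℝ → E n) = 0 := by funext t; simp [weighted]
    rw [this]
    exact MemLp.zero
  have hd := isWeakDeriv_opFDeriv (k := k) (u := 0) hV x hp hδ0 hw (by rw [prim_iterate_zero])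
    (by rwa [prim_iterate_zero])
  rw [prim_iterate_zero] at hd
  rw [wNorm_eq_sum hd]
  have hle : ∀ j ∈ Finset.range (k + 1),
      lpNorm p δ (opFDeriv lam V x 0 j) ≤ ENNReal.ofReal c := by
    intro j hj
    have hj' := Finset.mem_range.1 hj
    cases j with
    | zero =>
      have h1 : lpNorm p δ (integrand lam V x 0) ≤ ENNReal.ofReal c :=
        lpNorm_le_of_norm_le_exp hp hc fun t ht => by simpa using hx 0 (Nat.zero_le _) t ht
      refine (lpNorm_prim_le hp hδ0 hi.1).trans ?_
      refine (mul_le_of_le_one_left' ?_).trans h1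
      rw [ENNReal.ofReal_le_one, div_le_one hδ0]
      exact hδ
    | succ i => exact lpNorm_le_of_norm_le_exp hp hc (hx i (by omega))
  refine (Finset.sum_le_card_nsmul _ _ _ hle).trans_eq ?_
  rw [Finset.card_range, nsmul_eq_mul, ENNReal.ofReal_mul (by positivity), ← Nat.cast_succ,
    ENNReal.ofReal_natCast]

end

end MorseContraction

end

/-! ### Choice of constants and conclusion. -/

theorem mainTheorem7 {n : ℕ} (lam : Fin n → ℝ) (hlam : MorseContraction.NLinear lam)
    (V : MorseContraction.E n → MorseContraction.E n) (hV : ContDiff ℝ ∞ V)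
    (hsupp : HasCompactSupport fun x => V x - MorseContraction.standardForm lam x)
    (hflat : ∃ α₀ : ℕ, ∀ α : ℕ, α₀ ≤ α → ∃ K : ℝ, ∀ x : MorseContraction.E n,
      ‖V x - MorseContraction.standardForm lam x‖
        ≤ K * ‖MorseContraction.unstablePart lam x‖ ^ α
            * ‖MorseContraction.stablePart lam x‖ ^ α)
    (p : ℝ) (hp : 1 < p) (k : ℕ) (r : ℝ) (hr : 0 < r) :
    ∃ δ₀ : ℝ, 0 < δ₀ ∧ ∀ δ : ℝ, δ₀ ≤ δ →
      ∃ R₀ C : ℝ, 0 < R₀ ∧ 0 < C ∧ C < 1 ∧ ∀ R : ℝ, 0 < R → R ≤ R₀ →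
        ∀ x ∈ Metric.ball (0 : MorseContraction.E n) R,
          (∀ γ ∈ MorseContraction.Omega n p k δ r,
            IntegrableOn (MorseContraction.integrand lam V x γ) (Iic 0) ∧
            MorseContraction.opF lam V x γ ∈ MorseContraction.Omega n p k δ r) ∧
          ∀ γ₁ ∈ MorseContraction.Omega n p k δ r, ∀ γ₂ ∈ MorseContraction.Omega n p k δ r,
            MorseContraction.wNorm p k δ
                (MorseContraction.opF lam V x γ₁ - MorseContraction.opF lam V x γ₂)
              ≤ ENNReal.ofReal C * MorseContraction.wNorm p k δ (γ₁ - γ₂) := by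
  open MorseContraction in
  have hs : HasCompactSupport (nonlin lam V) := hsupp
  have hf : IsFlat lam V := hflat
  obtain ⟨D, hD0, hD⟩ := exists_wNorm_opF_sub_le hV hs hp k hr.le
  -- `2 * D` forces the contraction constant `D / δ ≤ 1/2`; `1` makes the `δ`-uniform bounds
  -- available.
  refine ⟨max 1 (2 * D), by positivity, fun δ hδ => ?_⟩
  have hδ1 : 1 ≤ δ := (le_max_left _ _).trans hδ
  have hδ0 : 0 < δ := by linarith
  have hDδ : D / δ ≤ 1 / 2 := by
    rw [div_le_iff₀ hδ0]
    linarith [(le_max_right 1 (2 * D)).trans hδ]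
  obtain ⟨A, hA0, hA⟩ := hf.exists_norm_iteratedDeriv_nonlin_flow_le hV hs k
    (by linarith : 0 ≤ δ + 1)
  -- The second entry gives `(k + 1) A R ≤ r / 2`, the bound needed for the image of the zero curve;
  -- the `+ 1` keeps the denominator positive when `A = 0`.
  refine ⟨min 1 (r / (2 * ((k + 1) * A + 1))), 1 / 2, by positivity, by norm_num, by norm_num,
    fun R hR0 hR x hx => ?_⟩
  have hxR : ‖x‖ ≤ R := (mem_ball_zero_iff.1 hx).le
  have hAx : ∀ j ≤ k, ∀ s ≤ 0,
      ‖iteratedDeriv j (integrand lam V x 0) s‖ ≤ A * R * Real.exp ((δ + 1) * s) := by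
    rw [integrand_zero]
    exact hA R hR0 (hR.trans (min_le_left _ _)) x hxR
  have hint : ∀ u, MemLp (weighted δ u) (ENNReal.ofReal p) (volume.restrict (Iic 0)) →
      IntegrableOn (integrand lam V x u) (Iic 0) := fun u hu =>
    integrableOn_integrand hV hs hp hδ0
      (fun s hs0 => by simpa using hAx 0 (Nat.zero_le _) s hs0) hu
  have hcontr : ∀ γ₁ ∈ Omega n p k δ r, ∀ γ₂ ∈ Omega n p k δ r,
      wNorm p k δ (opF lam V x γ₁ - opF lam V x γ₂)
        ≤ ENNReal.ofReal (1 / 2) * wNorm p k δ (γ₁ - γ₂) := fun γ₁ h₁ γ₂ h₂ =>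
    (hD δ hδ1 x hint γ₁ h₁ γ₂ h₂).trans (by gcongr)
  have h0mem : (0 : ℝ → E n) ∈ Omega n p k δ r := by
    refine ⟨?_, ?_⟩
    · simp [wSobolev, wNorm_zero]
    · simp [wNorm_zero]
  refine ⟨fun γ hγ => ⟨hint γ (memLp_weighted_of_wNorm_lt_top hγ.1), ?_⟩, hcontr⟩
  have hweak : ∀ u ∈ Omega n p k δ r, ∃ v : ℕ → ℝ → E n,
      ∀ j ≤ k, IsWeakDeriv j (opF lam V x u) (v j) := by
    intro u hu
    obtain ⟨w, hw, hae, -⟩ := exists_prim_iterate_of_wNorm_lt_top hp hδ0 hu.1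
    exact ⟨_, isWeakDeriv_opFDeriv hV x hp hδ0 hw hae (hint _
      ((memLp_weighted_prim_iterate hp hδ0 hw k).mono_measure Measure.restrict_le_self))⟩
  obtain ⟨v, hv⟩ := hweak γ hγ
  obtain ⟨v₀, hv₀⟩ := hweak 0 h0mem
  have hle : wNorm p k δ (opF lam V x γ) ≤ ENNReal.ofReal r := by
    have h1 : wNorm p k δ (opF lam V x γ - opF lam V x 0) ≤ ENNReal.ofReal (r / 2) := by
      refine (hcontr γ hγ 0 h0mem).trans ?_
      rw [sub_zero, show r / 2 = 1 / 2 * r by ring, ENNReal.ofReal_mul (by norm_num)]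
      gcongr
      exact hγ.2
    have h2 : wNorm p k δ (opF lam V x 0) ≤ ENNReal.ofReal (r / 2) := by
      refine (wNorm_opF_zero_le hV hp hδ1 (by positivity) hAx (hint 0
        (memLp_weighted_of_wNorm_lt_top h0mem.1))).trans (ENNReal.ofReal_le_ofReal ?_)
      have h3 := hR.trans (min_le_right _ _)
      rw [le_div_iff₀ (by positivity)] at h3
      nlinarith
    refine (wNorm_le_sub_add hp.le hv hv₀).trans ((add_le_add h1 h2).trans_eq ?_)
    rw [← ENNReal.ofReal_add (by positivity) (by positivity), add_halves]
  exact ⟨hle.trans_lt ENNReal.ofReal_lt_top, hle⟩
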